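/- **Setting.** Let $1<m<n$, let $M$ be a smooth $n$-manifold, $\check M$ a smooth $m$-manifold and $i:\check M\to M$ a smooth immersion. Let $F:TM\to[0,\infty)$ be a Finsler fundamental function: continuous, smooth off the zero section, positively homogeneous of degree 1 on the fibres, with positive definite fundamental tensor $g_{ab}=\frac12\,\partial^2F^2/\partial y^{(1)a}\partial y^{(1)b}$. Work in charts in which $i$ is $x^a=x^a(u^1,\dots,u^m)$, with the induced coordinates $(u,v^{(1)},v^{(2)})$ on $Osc^2\check M$ and $(x,y^{(1)},y^{(2)})$ on $Osc^2M$ (position, velocity and half the acceleration of a curve), at points with $v^{(1)}\neq0$. Sums over repeated indices are understood; $a,b,\dots\in\{1,\dots,n\}$, $\alpha,\beta,\dots\in\{1,\dots,m\}$, $\bar\alpha\in\{1,\dots,n-m\}$. *Nonlinear connections.* Dual coefficients $M_{(1)},M_{(2)}$ define the adapted cobasis $dx^a$, $\delta y^{(1)a}=dy^{(1)a}+M_{(1)}{}^a_b\,dx^b$, $\delta y^{(2)a}=dy^{(2)a}+M_{(1)}{}^a_b\,dy^{(1)b}+M_{(2)}{}^a_b\,dx^b$ and its dual, the adapted basis $\delta_a=\delta_{0a},\delta_{1a},\delta_{2a}$.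 Let $B_{(qt)}{}^a_{bc}$ be the $\delta_{ta}$-component of $[\delta_b,\delta_{qc}]$ and $R_{(qt)}{}^a_{bc}$ the $\delta_{ta}$-component of $[\delta_{qb},\delta_{qc}]$. On $Osc^2M$ take $M_{(1)}{}^a_b=\partial G^a/\partial y^{(1)b}$, $M_{(2)}{}^a_b=\frac12(\mathbf\Gamma M_{(1)}{}^a_b+M_{(1)}{}^a_dM_{(1)}{}^d_b)$, where $G^a=\frac12\gamma^a_{bc}y^{(1)b}y^{(1)c}$, $\gamma^a_{bc}=\frac12g^{ad}(\partial_{x^b}g_{dc}+\partial_{x^c}g_{bd}-\partial_{x^d}g_{bc})$ and $\mathbf\Gamma=y^{(1)a}\partial_{x^a}+2y^{(2)a}\partial_{y^{(1)a}}$. *Canonical metrical N-linear connection on $Osc^2M$.* Write $\Gamma_{(i0)}=L_{(i0)}$, $\Gamma_{(i1)}=C_{(i1)}$, $\Gamma_{(i2)}=C_{(i2)}$ for $i=0,1,2$. Then $$\Gamma_{(ii)}{}^a_{bc}=\tfrac12g^{ad}(\delta_{ib}g_{dc}+\delta_{ic}g_{bd}-\delta_{id}g_{bc}),\qquad C_{(ir)}{}^a_{bc}=\tfrac12g^{ad}\delta_{rc}g_{bd}\quad(r=1,2,\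 r\ne i),$$ $$L_{(j0)}{}^a_{bc}=B_{(jj)}{}^a_{cb}+\tfrac12g^{ad}(\delta_cg_{bd}-B_{(jj)}{}^f_{cb}g_{fd}-B_{(jj)}{}^f_{cd}g_{bf})\quad(j=1,2).$$ *Induced objects on $Osc^2\check M$.* Let $B^a_\alpha=\partial x^a/\partial u^\alpha$ and $B^a_{\alpha\beta}=\partial^2x^a/\partial u^\alpha\partial u^\beta$. Fix, over an open set of points $(u,v^{(1)},v^{(2)})$ with $v^{(1)}\ne0$, vectors $B^a_{\bar\alpha}$ that are $g$-orthonormal and $g$-orthogonal to all $B^a_\alpha$, and let $(B^\alpha_a,B^{\bar\alpha}_a)$ be the frame dual to $(B^a_\alpha,B^a_{\bar\alpha})$. The induced nonlinear connection is the one with $\delta v^{(r)\alpha}=B^\alpha_a\,\delta y^{(r)a}$, $r=1,2$ (forms restricted by $Osc^2i$); $\delta_\alpha,\delta_{1\alpha},\delta_{2\alpha}$, $B_{(qt)}{}^\sigma_{\beta\gamma}$ and $R_{(qt)}{}^\sigma_{\beta\gamma}$ now refer to it. Let $K_{(r)}{}^{\bar\alpha}_\beta=B^{\bar\alpha}_a\,\delta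 y^{(r)a}((Osc^2i)_*\delta_\beta)$ and $$\check L_{(i0)}{}^a_{b\delta}=L_{(i0)}{}^a_{bd}B^d_\delta+C_{(i1)}{}^a_{bd}B^d_{\bar\delta}K_{(1)}{}^{\bar\delta}_\delta+C_{(i2)}{}^a_{bd}B^d_{\bar\delta}K_{(2)}{}^{\bar\delta}_\delta,$$ $$\check C_{(i1)}{}^a_{b\delta}=C_{(i1)}{}^a_{bd}B^d_\delta+C_{(i2)}{}^a_{bd}B^d_{\bar\delta}K_{(1)}{}^{\bar\delta}_\delta,\qquad\check C_{(i2)}{}^a_{b\delta}=C_{(i2)}{}^a_{bd}B^d_\delta .$$ The induced tangent N-linear connection has the coefficients $L_{(i0)}{}^\alpha_{\beta\delta}=B^\alpha_d(B^d_{\beta\delta}+B^f_\beta\check L_{(i0)}{}^d_{f\delta})$ and $C_{(ir)}{}^\alpha_{\beta\delta}=B^\alpha_dB^f_\beta\check C_{(ir)}{}^d_{f\delta}$, $r=1,2$; below, $\Gamma_{(i0)}=L_{(i0)}$, $\Gamma_{(ir)}=C_{(ir)}$ denote these. Its relative covariant derivatives are, with $\overset{(0)}{|}_{i\gamma}$ meaning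 ${}_{|i\gamma}$ and $r=0,1,2$, $$X^\alpha\overset{(r)}{|}_{i\gamma}=\delta_{r\gamma}X^\alpha+\Gamma_{(ir)}{}^\alpha_{\sigma\gamma}X^\sigma,\qquad T^\alpha_\beta\overset{(r)}{|}_{i\gamma}=\delta_{r\gamma}T^\alpha_\beta+\Gamma_{(ir)}{}^\alpha_{\sigma\gamma}T^\sigma_\beta-\Gamma_{(ir)}{}^\sigma_{\beta\gamma}T^\alpha_\sigma .$$ *Curvature and torsion.* For each $i$ let $\nabla_{(i)}$ be the covariant derivative of d-vector fields with connection 1-forms $\omega_{(i)}{}^\alpha_\beta=L_{(i0)}{}^\alpha_{\beta\delta}du^\delta+C_{(i1)}{}^\alpha_{\beta\delta}\delta v^{(1)\delta}+C_{(i2)}{}^\alpha_{\beta\delta}\delta v^{(2)\delta}$, acting on vector fields on $Osc^2\check M$ through each of their three d-vector components. Let $\mathcal R_{(i)}(V,W)=[\nabla_V,\nabla_W]-\nabla_{[V,W]}$ be its curvature on d-vector fields and $\mathcal T_{(i)}(V,W)=\nabla_VW-\nabla_WV-[V,W]$ its torsion. Let $e_\delta$ be the $\delta$-th basis d-vector,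 with components $\delta^\alpha_\delta$. For $l=1,2$: - $R_{(0i)\delta}{}^\alpha{}_{\beta\gamma}$, $P_{(li)\delta}{}^\alpha{}_{\beta\gamma}$, $Q_{(2i)\delta}{}^\alpha{}_{\beta\gamma}$, $S_{(li)\delta}{}^\alpha{}_{\beta\gamma}$ are the $\alpha$-components of $\mathcal R_{(i)}(V,W)e_\delta$ for $(V,W)=(\delta_\gamma,\delta_\beta)$, $(\delta_{l\gamma},\delta_\beta)$, $(\delta_{2\gamma},\delta_{1\beta})$, $(\delta_{l\gamma},\delta_{l\beta})$, respectively; - $T^{(i)}_{(0)}{}^\sigma_{\beta\gamma}$, $P^{(i)}_{(ll)}{}^\sigma_{\beta\gamma}$, $Q^{(i)}_{(22)}{}^\sigma_{\beta\gamma}$, $S^{(i)}_{(l)}{}^\sigma_{\beta\gamma}$ are the components of $\mathcal T_{(i)}(V,W)$ for the same pairs along $\delta_\sigma$, $\delta_{l\sigma}$, $\delta_{2\sigma}$, $\delta_{l\sigma}$, respectively; - $P_{(12)}=B_{(12)}$, $P_{(21)}=B_{(21)}$. *Deflection tensors.* Let $z^{(1)\alpha}=v^{(1)\alpha}$ and $z^{(2)\alpha}=v^{(2)\alpha}+\frac12M_{(1)}{}^\alpha_\beta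 v^{(1)\beta}$ be the Liouville d-vector fields of $Osc^2\check M$ ($M_{(1)}{}^\alpha_\beta$ the first dual coefficients of the induced nonlinear connection). For $j,l=1,2$ put $$\overset{(j)}{\underset iD}{}^\alpha_\beta=z^{(j)\alpha}{}_{|i\beta},\qquad\overset{(jl)}{\underset id}{}^\alpha_\beta=z^{(j)\alpha}\overset{(l)}{|}_{i\beta}.$$ **Theorem 5.2.** For $i=0,1,2$, $j,l=1,2$ and all $\alpha,\beta,\gamma$, the deflection tensor fields satisfy $$\overset{(j)}{\underset iD}{}^\alpha_{\beta|i\gamma}-\overset{(j)}{\underset iD}{}^\alpha_{\gamma|i\beta}=z^{(j)\delta}R_{(0i)\delta}{}^\alpha{}_{\beta\gamma}-\overset{(j)}{\underset iD}{}^\alpha_\delta\,T^{(i)}_{(0)}{}^\delta_{\beta\gamma}-\overset{(j1)}{\underset id}{}^\alpha_\delta R_{(01)}{}^\delta_{\beta\gamma}-\overset{(j2)}{\underset id}{}^\alpha_\delta R_{(02)}{}^\delta_{\beta\gamma},$$ $$\overset{(j)}{\underset iD}{}^\alpha_\beta\overset{(1)}{|}_{i\gamma}-\overset{(j1)}{\underset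 id}{}^\alpha_{\gamma|i\beta}=z^{(j)\delta}P_{(1i)\delta}{}^\alpha{}_{\beta\gamma}-\overset{(j)}{\underset iD}{}^\alpha_\delta C_{(i1)}{}^\delta_{\beta\gamma}-\overset{(j1)}{\underset id}{}^\alpha_\delta P^{(i)}_{(11)}{}^\delta_{\beta\gamma}-\overset{(j2)}{\underset id}{}^\alpha_\delta P_{(12)}{}^\delta_{\beta\gamma},$$ $$\overset{(j)}{\underset iD}{}^\alpha_\beta\overset{(2)}{|}_{i\gamma}-\overset{(j2)}{\underset id}{}^\alpha_{\gamma|i\beta}=z^{(j)\delta}P_{(2i)\delta}{}^\alpha{}_{\beta\gamma}-\overset{(j)}{\underset iD}{}^\alpha_\delta C_{(i2)}{}^\delta_{\beta\gamma}-\overset{(j1)}{\underset id}{}^\alpha_\delta P_{(21)}{}^\delta_{\beta\gamma}-\overset{(j2)}{\underset id}{}^\alpha_\delta P^{(i)}_{(22)}{}^\delta_{\beta\gamma},$$ $$\overset{(j1)}{\underset id}{}^\alpha_\beta\overset{(2)}{|}_{i\gamma}-\overset{(j2)}{\underset id}{}^\alpha_\gamma\overset{(1)}{|}_{i\beta}=z^{(j)\delta}Q_{(2i)\delta}{}^\alpha{}_{\beta\gamma}-\overset{(j1)}{\underset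 id}{}^\alpha_\delta C_{(i2)}{}^\delta_{\beta\gamma}-\overset{(j2)}{\underset id}{}^\alpha_\delta Q^{(i)}_{(22)}{}^\delta_{\beta\gamma},$$ $$\overset{(jl)}{\underset id}{}^\alpha_\beta\overset{(l)}{|}_{i\gamma}-\overset{(jl)}{\underset id}{}^\alpha_\gamma\overset{(l)}{|}_{i\beta}=z^{(j)\delta}S_{(li)\delta}{}^\alpha{}_{\beta\gamma}-\overset{(jl)}{\underset id}{}^\alpha_\delta S^{(i)}_{(l)}{}^\delta_{\beta\gamma}-\overset{(j2)}{\underset id}{}^\alpha_\delta R_{(l2)}{}^\delta_{\beta\gamma},$$ where $R_{(22)}{}^\alpha_{\beta\gamma}=0$. -/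

import Mathlib

open scoped Manifold ContDiff

noncomputable section

namespace Osc2

/-! ### Coordinates on the 2-osculator bundle

A chart of a `k`-manifold with image `U ⊆ ℝᵏ` induces a chart of its 2-osculator bundle with image
`U × ℝᵏ × ℝᵏ`: the 2-jet at `0` of a curve `ρ`, written `x(t)` in the chart, has the coordinates
`(x(0), x'(0), x''(0) / 2)`.  Local fields on the bundle are functions of these coordinates. -/

/-- Coordinate space of a `k`-dimensional manifold. -/
abbrev Crd (k : ℕ) : Type := EuclideanSpace ℝ (Fin k)

/-- Coordinate space `(x, y⁽¹⁾, y⁽²⁾)` of the 2-osculator bundle of a `k`-dimensional manifold. -/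
abbrev Osc (k : ℕ) : Type := Crd k × Crd k × Crd k

/-- The standard basis of the coordinate space. -/
def bas {k : ℕ} (a : Fin k) : Crd k := EuclideanSpace.single a 1

/-- The natural basis: `nat 0 a = ∂/∂xᵃ`, `nat 1 a = ∂/∂y⁽¹⁾ᵃ`, `nat 2 a = ∂/∂y⁽²⁾ᵃ`. -/
def nat {k : ℕ} (r : Fin 3) (a : Fin k) : Osc k :=
  match r with
  | 0 => (bas a, 0, 0)
  | 1 => (0, bas a, 0)
  | 2 => (0, 0, bas a)

/-- Derivative of the function `f` along the vector field `X`. -/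
def dir {k : ℕ} (X : Osc k → Osc k) (f : Osc k → ℝ) (p : Osc k) : ℝ := fderiv ℝ f p (X p)

/-! ### Nonlinear connections -/

/-- A nonlinear connection, given by its dual coefficients `M₍₁₎ᵃ_b = M1 p a b` and
`M₍₂₎ᵃ_b = M2 p a b`. -/
structure NonlinearConnection (k : ℕ) where
  /-- first dual coefficients -/
  M1 : Osc k → Matrix (Fin k) (Fin k) ℝ
  /-- second dual coefficients -/
  M2 : Osc k → Matrix (Fin k) (Fin k) ℝ

/-- The adapted cobasis `dxᵃ`, `δy⁽¹⁾ᵃ = dy⁽¹⁾ᵃ + M₍₁₎ᵃ_b dxᵇ`,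
`δy⁽²⁾ᵃ = dy⁽²⁾ᵃ + M₍₁₎ᵃ_b dy⁽¹⁾ᵇ + M₍₂₎ᵃ_b dxᵇ` (`r = 0, 1, 2`), at `p`, on the vector `w`. -/
def cobasis {k : ℕ} (N : NonlinearConnection k) (r : Fin 3) (a : Fin k) (p w : Osc k) : ℝ :=
  match r with
  | 0 => w.1 a
  | 1 => w.2.1 a + ∑ b, N.M1 p a b * w.1 b
  | 2 => w.2.2 a + ∑ b, N.M1 p a b * w.2.1 b + ∑ b, N.M2 p a b * w.1 b

/-- The adapted basis `δ_a`, `δ_{1a}`, `δ_{2a} = ∂/∂y⁽²⁾ᵃ` (`r = 0, 1, 2`), the basis dual to the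
adapted cobasis. -/
def basis {k : ℕ} (N : NonlinearConnection k) (r : Fin 3) (a : Fin k) (p : Osc k) : Osc k :=
  match r with
  | 0 => nat 0 a - ∑ b, N.M1 p b a • nat 1 b - ∑ b, (N.M2 p - N.M1 p * N.M1 p) b a • nat 2 b
  | 1 => nat 1 a - ∑ b, N.M1 p b a • nat 2 b
  | 2 => nat 2 a

/-- The component along `δ_{tσ}` of the Lie bracket `[δ_{rβ}, δ_{sγ}]` of adapted basis fields. -/
def bracketCoeff {k : ℕ} (N : NonlinearConnection k) (r s t : Fin 3) (σ β γ : Fin k)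
    (p : Osc k) : ℝ :=
  cobasis N t σ p (VectorField.lieBracket ℝ (basis N r β) (basis N s γ) p)

/-! ### N-linear connections -/

/-- The nine systems of coefficients of an N-linear connection: for `i = 0, 1, 2`,
`Γ i 0 a b c = L_(i0)ᵃ_bc`, `Γ i 1 a b c = C_(i1)ᵃ_bc`, `Γ i 2 a b c = C_(i2)ᵃ_bc`, where the last
lower index is the direction of differentiation. -/
abbrev NLinear (k : ℕ) : Type := Fin 3 → Fin 3 → Fin k → Fin k → Fin k → Osc k → ℝ

section Connection

variable {k : ℕ} (N : NonlinearConnection k) (Γ : NLinear k)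

/-- `Xᵅ|_{iβ}` (`r = 0`) and `Xᵅ|⁽ʳ⁾_{iβ}` (`r = 1, 2`) for a d-vector field `X`. -/
def covVec (i r : Fin 3) (X : Fin k → Osc k → ℝ) (α β : Fin k) (p : Osc k) : ℝ :=
  dir (basis N r β) (X α) p + ∑ γ, Γ i r α γ β p * X γ p

/-- `Tᵅ_β|_{iγ}` (`r = 0`) and `Tᵅ_β|⁽ʳ⁾_{iγ}` (`r = 1, 2`) for a d-tensor field `T` of type
`(1, 1)`. -/
def covTensor (i r : Fin 3) (T : Fin k → Fin k → Osc k → ℝ) (α β γ : Fin k) (p : Osc k) : ℝ :=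
  dir (basis N r γ) (T α β) p + ∑ σ, Γ i r α σ γ p * T σ β p - ∑ σ, Γ i r σ β γ p * T α σ p

/-- The covariant derivative `∇_(i)` of the d-vector field `X` along the vector field `V`:
`dXᵅ(V) + X^γ ω_(i)^α_γ(V)`, with the connection 1-forms
`ω_(i)^α_γ = L_(i0)^α_γβ dx^β + C_(i1)^α_γβ δy⁽¹⁾^β + C_(i2)^α_γβ δy⁽²⁾^β`. -/
def covAlong (i : Fin 3) (V : Osc k → Osc k) (X : Fin k → Osc k → ℝ) (α : Fin k)
    (p : Osc k) : ℝ :=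
  dir V (X α) p + ∑ γ, X γ p * ∑ r, ∑ β, Γ i r α γ β p * cobasis N r β p (V p)

/-- The curvature `∇_V ∇_W X - ∇_W ∇_V X - ∇_[V,W] X` of `∇ = ∇_(i)`. -/
def curvature (i : Fin 3) (V W : Osc k → Osc k) (X : Fin k → Osc k → ℝ) (α : Fin k)
    (p : Osc k) : ℝ :=
  covAlong N Γ i V (covAlong N Γ i W X) α p - covAlong N Γ i W (covAlong N Γ i V X) α p
    - covAlong N Γ i (VectorField.lieBracket ℝ V W) X α p

/-- The torsion `∇_V W - ∇_W V - [V, W]` of `∇ = ∇_(i)`, which acts on a vector field through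
each of its three d-vector components; component along `δ_{tσ}`. -/
def torsion (i : Fin 3) (V W : Osc k → Osc k) (t : Fin 3) (σ : Fin k) (p : Osc k) : ℝ :=
  covAlong N Γ i V (fun τ q => cobasis N t τ q (W q)) σ p
    - covAlong N Γ i W (fun τ q => cobasis N t τ q (V q)) σ p
    - cobasis N t σ p (VectorField.lieBracket ℝ V W p)

/-- The curvature components: the `α`-component of the curvature of `∇_(i)` on
`(δ_{sγ}, δ_{rβ})` and the `δ`-th basis d-vector. -/
def curvCoeff (i r s : Fin 3) (δ α β γ : Fin k) (p : Osc k) : ℝ :=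
  curvature N Γ i (basis N s γ) (basis N r β) (fun τ _ => if τ = δ then 1 else 0) α p

/-- The torsion components: the component along `δ_{tσ}` of the torsion of `∇_(i)` on
`(δ_{sγ}, δ_{rβ})`. -/
def torsCoeff (i r s t : Fin 3) (σ β γ : Fin k) (p : Osc k) : ℝ :=
  torsion N Γ i (basis N s γ) (basis N r β) t σ p

/-! The curvature and torsion d-tensors under their usual names.  The curvature tensors have the
index order `δ α β γ` of `R_δ^α_βγ`, the torsion tensors the order `σ β γ` of `T^σ_βγ`. -/

/-- The curvature d-tensor `R_(0i)`. -/
def curvR (i : Fin 3) := curvCoeff N Γ i 0 0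

/-- The curvature d-tensors `P_(1i)` and `P_(2i)` (`l = 1, 2`). -/
def curvP (l i : Fin 3) := curvCoeff N Γ i 0 l

/-- The curvature d-tensor `Q_(2i)`. -/
def curvQ (i : Fin 3) := curvCoeff N Γ i 1 2

/-- The curvature d-tensors `S_(1i)` and `S_(2i)` (`l = 1, 2`). -/
def curvS (l i : Fin 3) := curvCoeff N Γ i l l

/-- The torsion d-tensor `T⁽ⁱ⁾_(0)`. -/
def torsT (i : Fin 3) := torsCoeff N Γ i 0 0 0

/-- The torsion d-tensors `P⁽ⁱ⁾_(11)` and `P⁽ⁱ⁾_(22)` (`l = 1, 2`). -/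
def torsPdiag (l i : Fin 3) := torsCoeff N Γ i 0 l l

/-- The torsion d-tensor `Q⁽ⁱ⁾_(22)`. -/
def torsQ (i : Fin 3) := torsCoeff N Γ i 1 2 2

/-- The torsion d-tensors `S⁽ⁱ⁾_(1)` and `S⁽ⁱ⁾_(2)` (`l = 1, 2`). -/
def torsS (l i : Fin 3) := torsCoeff N Γ i l l l

/-- The d-tensors `R_(01)`, `R_(02)`, `R_(12)`, `R_(22)`: `R_(rt)^σ_βγ` is the component along
`δ_{tσ}` of `[δ_{rβ}, δ_{rγ}]`. -/
def torsR (r t : Fin 3) := bracketCoeff N r r t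

/-- The d-tensors `P_(12)` and `P_(21)`: `P_(st)^σ_βγ` is the component along `δ_{tσ}` of
`[δ_β, δ_{sγ}]`. -/
def torsPmixed (s t : Fin 3) := bracketCoeff N 0 s t

/-- The Liouville d-vector fields `z⁽¹⁾ᵅ = v⁽¹⁾ᵅ` (`j = 0`) and
`z⁽²⁾ᵅ = v⁽²⁾ᵅ + ½ M₍₁₎ᵅ_β v⁽¹⁾ᵝ` (`j = 1`). -/
def liouville (j : Fin 2) (α : Fin k) (p : Osc k) : ℝ :=
  match j with
  | 0 => p.2.1 α
  | 1 => p.2.2 α + (1 / 2) * ∑ β, N.M1 p α β * p.2.1 β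

/-- The deflection tensor fields of `z⁽ʲ⁾` (`j = 0` for `z⁽¹⁾`, `j = 1` for `z⁽²⁾`): the covariant
derivatives `z⁽ʲ⁾ᵅ|_{iβ}` (`r = 0`) and `z⁽ʲ⁾ᵅ|⁽ʳ⁾_{iβ}` (`r = 1, 2`). -/
def deflection (j : Fin 2) (i r : Fin 3) : Fin k → Fin k → Osc k → ℝ :=
  covVec N Γ i r (liouville N j)

end Connection

/-! ### Finsler spaces: the nonlinear connection and the canonical metrical N-linear connection -/

section Finsler

variable {k : ℕ} (Φ : Crd k → Crd k → ℝ)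

/-- The fundamental tensor `g_ab = ½ ∂²F² / ∂y⁽¹⁾ᵃ ∂y⁽¹⁾ᵇ` of the fundamental function
`F = Φ(x, y⁽¹⁾)`. -/
def fundTensor (p : Osc k) : Matrix (Fin k) (Fin k) ℝ :=
  Matrix.of fun a b =>
    (1 / 2) * fderiv ℝ (fun y => fderiv ℝ (fun y' => Φ p.1 y' ^ 2) y (bas b)) p.2.1 (bas a)

/-- The Christoffel symbols `γᵃ_bc(x, y⁽¹⁾)` of the fundamental tensor. -/
def christoffel (a b c : Fin k) (p : Osc k) : ℝ :=
  (1 / 2) * ∑ d, (fundTensor Φ p)⁻¹ a d *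
    (dir (fun _ => nat 0 b) (fun q => fundTensor Φ q d c) p
      + dir (fun _ => nat 0 c) (fun q => fundTensor Φ q b d) p
      - dir (fun _ => nat 0 d) (fun q => fundTensor Φ q b c) p)

/-- `Gᵃ = ½ γᵃ_bc y⁽¹⁾ᵇ y⁽¹⁾ᶜ`. -/
def spray (a : Fin k) (p : Osc k) : ℝ :=
  (1 / 2) * ∑ b, ∑ c, christoffel Φ a b c p * p.2.1 b * p.2.1 c

/-- `∂Gᵃ / ∂y⁽¹⁾ᵇ`. -/
def cartanM1 (p : Osc k) : Matrix (Fin k) (Fin k) ℝ :=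
  Matrix.of fun a b => dir (fun _ => nat 1 b) (spray Φ a) p

/-- The nonlinear connection of the Finsler space: `M₍₁₎ᵃ_b = ∂Gᵃ / ∂y⁽¹⁾ᵇ` and
`M₍₂₎ᵃ_b = ½ (Γ M₍₁₎ᵃ_b + M₍₁₎ᵃ_d M₍₁₎ᵈ_b)`, where
`Γ = y⁽¹⁾ᵃ ∂/∂xᵃ + 2 y⁽²⁾ᵃ ∂/∂y⁽¹⁾ᵃ`. -/
def finslerConnection : NonlinearConnection k where
  M1 := cartanM1 Φ
  M2 := fun p => Matrix.of fun a b =>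
    (1 / 2) * (dir (fun q => (q.2.1, (2 : ℝ) • q.2.2, 0)) (fun q => cartanM1 Φ q a b) p
      + ∑ d, cartanM1 Φ p a d * cartanM1 Φ p d b)

/-- The canonical metrical N-linear connection of the Finsler space.  The first case covers `L_(00)`,
`C_(11)`, `C_(22)`, the second `L_(10)` and `L_(20)`, with `B_(jj)ᵃ_bc` the component along
`δ_{ja}` of `[δ_b, δ_{jc}]`, the third `C_(01)`, `C_(21)`, `C_(02)`, `C_(12)`. -/
def canonicalConnection : NLinear k := fun i r a b c p =>
  let N := finslerConnection Φ
  let g := fundTensor Φ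
  let B := bracketCoeff N 0 i i
  if r = i then
    (1 / 2) * ∑ d, (g p)⁻¹ a d * (dir (basis N i b) (fun q => g q d c) p
      + dir (basis N i c) (fun q => g q b d) p - dir (basis N i d) (fun q => g q b c) p)
  else if r = 0 then
    B a c b p + (1 / 2) * ∑ d, (g p)⁻¹ a d * (dir (basis N 0 c) (fun q => g q b d) p
      - ∑ f, B f c b p * g p f d - ∑ f, B f c d p * g p b f)
  else
    (1 / 2) * ∑ d, (g p)⁻¹ a d * dir (basis N r c) (fun q => g q b d) p

end Finsler

/-! ### Submanifolds -/

section Submanifold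

variable {m n : ℕ}

/-- The local expression of the map `Osc² i` between 2-osculator bundles, for a map `i` with the
local expression `x`. -/
def oscMap (x : Crd m → Crd n) (p : Osc m) : Osc n :=
  (x p.1, fderiv ℝ x p.1 p.2.1,
    (1 / 2 : ℝ) • fderiv ℝ (fun u => fderiv ℝ x u p.2.1) p.1 p.2.1 + fderiv ℝ x p.1 p.2.2)

/-- `Bᵃ_α = ∂xᵃ / ∂uᵅ`. -/
def tangentB (x : Crd m → Crd n) (u : Crd m) : Matrix (Fin n) (Fin m) ℝ :=
  Matrix.of fun a α => fderiv ℝ x u (bas α) a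

/-- `Bᵃ_αβ = ∂²xᵃ / ∂uᵅ ∂uᵝ`. -/
def secondB (x : Crd m → Crd n) (a : Fin n) (α β : Fin m) (u : Crd m) : ℝ :=
  fderiv ℝ (fun u' => tangentB x u' a α) u (bas β)

/-- The fields that complete `Bᵃ_α` to a moving frame along the submanifold: the normal vectors
`Bᵃ_ᾱ = normal p a ᾱ` and the dual frame `Bᵅ_a = cotangent p α a`, `B^ᾱ_a = conormal p ᾱ a`. -/
structure MovingFrame (m n : ℕ) where
  /-- `Bᵃ_ᾱ` -/
  normal : Osc m → Matrix (Fin n) (Fin (n - m)) ℝ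
  /-- `Bᵅ_a` -/
  cotangent : Osc m → Matrix (Fin m) (Fin n) ℝ
  /-- `B^ᾱ_a` -/
  conormal : Osc m → Matrix (Fin (n - m)) (Fin n) ℝ

/-- The defining conditions of a moving frame at `p`, for the fundamental function `Φ` and the
submanifold `x`: the normals are orthonormal and orthogonal to the `Bᵃ_α`, and the two frames are
dual to each other. -/
structure MovingFrame.IsAdapted (R : MovingFrame m n) (Φ : Crd n → Crd n → ℝ)
    (x : Crd m → Crd n) (p : Osc m) : Prop where
  orthogonal : (tangentB x p.1).transpose * fundTensor Φ (oscMap x p) * R.normal p = 0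
  orthonormal : (R.normal p).transpose * fundTensor Φ (oscMap x p) * R.normal p = 1
  cotangent_tangent : R.cotangent p * tangentB x p.1 = 1
  cotangent_normal : R.cotangent p * R.normal p = 0
  conormal_tangent : R.conormal p * tangentB x p.1 = 0
  conormal_normal : R.conormal p * R.normal p = 1
  complete : tangentB x p.1 * R.cotangent p + R.normal p * R.conormal p = 1

variable (Φ : Crd n → Crd n → ℝ) (x : Crd m → Crd n) (R : MovingFrame m n)

/-- The 1-form `δy⁽ʳ⁾ᵃ` restricted to the submanifold, at `p`, on the vector `w`. -/
def restrictedCobasis (r : Fin 3) (a : Fin n) (p w : Osc m) : ℝ :=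
  cobasis (finslerConnection Φ) r a (oscMap x p) (fderiv ℝ (oscMap x) p w)

/-- The induced nonlinear connection, the one with `δv⁽¹⁾ᵅ = Bᵅ_a δy⁽¹⁾ᵃ` and
`δv⁽²⁾ᵅ = Bᵅ_a δy⁽²⁾ᵃ`: its dual coefficients are the values of these 1-forms on `∂/∂uᵝ`. -/
def inducedNonlinear : NonlinearConnection m where
  M1 := fun p => Matrix.of fun α β =>
    ∑ a, R.cotangent p α a * restrictedCobasis Φ x 1 a p (nat 0 β)
  M2 := fun p => Matrix.of fun α β =>
    ∑ a, R.cotangent p α a * restrictedCobasis Φ x 2 a p (nat 0 β)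

/-- The mixed d-tensors `K_(1)` and `K_(2)` (`r = 1, 2`): `K_(r)^ᾱ_β` is the coefficient of
`B^a_ᾱ du^β` in the representation of `δy⁽ʳ⁾ᵃ` in the moving frame and the adapted cobasis
`(du, δv⁽¹⁾, δv⁽²⁾)`, that is `B^ᾱ_a δy⁽ʳ⁾ᵃ` on the adapted basis field `δ_β`. -/
def tensorK (r : Fin 3) (α' : Fin (n - m)) (β : Fin m) (p : Osc m) : ℝ :=
  ∑ a, R.conormal p α' a * restrictedCobasis Φ x r a p (basis (inducedNonlinear Φ x R) 0 β p)

/-- The coefficients `Ľ_(i0)ᵃ_bδ`, `Č_(i1)ᵃ_bδ`, `Č_(i2)ᵃ_bδ` (`r = 0, 1, 2`) of the coupling of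
the canonical metrical N-linear connection to the induced nonlinear connection. -/
def coupling (i r : Fin 3) (a b : Fin n) (δ : Fin m) (p : Osc m) : ℝ :=
  let Γ := canonicalConnection Φ
  let q := oscMap x p
  match r with
  | 0 => ∑ d, (Γ i 0 a b d q * tangentB x p.1 d δ
      + Γ i 1 a b d q * ∑ δ', R.normal p d δ' * tensorK Φ x R 1 δ' δ p
      + Γ i 2 a b d q * ∑ δ', R.normal p d δ' * tensorK Φ x R 2 δ' δ p)
  | 1 => ∑ d, (Γ i 1 a b d q * tangentB x p.1 d δ
      + Γ i 2 a b d q * ∑ δ', R.normal p d δ' * tensorK Φ x R 1 δ' δ p)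
  | 2 => ∑ d, Γ i 2 a b d q * tangentB x p.1 d δ

/-- The induced tangent N-linear connection. -/
def inducedTangent : NLinear m := fun i r α β δ p =>
  match r with
  | 0 => ∑ d, R.cotangent p α d *
      (secondB x d β δ p.1 + ∑ f, tangentB x p.1 f β * coupling Φ x R i 0 d f δ p)
  | 1 => ∑ d, R.cotangent p α d * ∑ f, tangentB x p.1 f β * coupling Φ x R i 1 d f δ p
  | 2 => ∑ d, R.cotangent p α d * ∑ f, tangentB x p.1 f β * coupling Φ x R i 2 d f δ p

end Submanifold

/-! ### Manifolds -/

section Manifold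

/-- `F` is the fundamental function of a Finsler space: continuous on the tangent bundle, smooth off
the zero section, nonnegative, positively homogeneous of degree 1 on the fibres, and with a positive
definite fundamental tensor. -/
structure IsFinsler {n : ℕ} {M : Type*} [TopologicalSpace M] [ChartedSpace (Crd n) M]
    [IsManifold (𝓡 n) ∞ M] (F : TangentBundle (𝓡 n) M → ℝ) : Prop where
  continuous : Continuous F
  smooth : ContMDiffOn (𝓡 n).tangent 𝓘(ℝ, ℝ) ∞ F {w | w.2 ≠ 0}
  nonneg : ∀ w, 0 ≤ F w
  homogeneous : ∀ (q : M) (w : TangentSpace (𝓡 n) q) (c : ℝ), 0 < c → F ⟨q, c • w⟩ = c * F ⟨q, w⟩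
  posDef : ∀ (q : M) (v w : TangentSpace (𝓡 n) q), v ≠ 0 → w ≠ 0 →
    0 < iteratedDeriv 2 (fun t : ℝ => F ⟨q, v + t • w⟩ ^ 2) 0

/-- `f` is a smooth immersion. -/
def IsSmoothImmersion {m n : ℕ} {M' M : Type*} [TopologicalSpace M'] [ChartedSpace (Crd m) M']
    [TopologicalSpace M] [ChartedSpace (Crd n) M] (f : M' → M) : Prop :=
  ContMDiff (𝓡 m) (𝓡 n) ∞ f ∧ ∀ q, Function.Injective (mfderiv (𝓡 m) (𝓡 n) f q)

/-- The local expression of `F` in the chart `ψ`: the value of `F` at the tangent vector with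
components `y` at the point with coordinates `x`. -/
def chartFinsler {n : ℕ} {M : Type*} [TopologicalSpace M] [ChartedSpace (Crd n) M]
    (F : TangentBundle (𝓡 n) M → ℝ) (ψ : OpenPartialHomeomorph M (Crd n)) (x y : Crd n) : ℝ :=
  F ⟨ψ.symm x, mfderiv (𝓡 n) (𝓡 n) ψ.symm x y⟩

/-- The parametric equations `x = x(u)` of the immersion `f` in the charts `φ` and `ψ`. -/
def chartMap {m n : ℕ} {M' M : Type*} [TopologicalSpace M'] [TopologicalSpace M] (f : M' → M)
    (φ : OpenPartialHomeomorph M' (Crd m)) (ψ : OpenPartialHomeomorph M (Crd n)) (u : Crd m) :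
    Crd n :=
  ψ (f (φ.symm u))

/-- The coordinates `(u, v⁽¹⁾, v⁽²⁾)`, `v⁽¹⁾ ≠ 0`, of the points of the 2-osculator bundle over the
domain on which the parametric equations are valid.  Points with `v⁽¹⁾ = 0` are excluded since the
fundamental tensor is defined off the zero section only. -/
def slitDomain {m n : ℕ} {M' M : Type*} [TopologicalSpace M'] [TopologicalSpace M] (f : M' → M)
    (φ : OpenPartialHomeomorph M' (Crd m)) (ψ : OpenPartialHomeomorph M (Crd n)) :
    Set (Osc m) :=
  {p | p.1 ∈ φ.target ∧ f (φ.symm p.1) ∈ ψ.source ∧ p.2.1 ≠ 0}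

end Manifold

end Osc2

end

open Osc2

/-!
The five formulas are instances of the Ricci identity for the covariant derivatives of a d-vector
field `X`, here a Liouville field.  For adapted basis fields `V = δ_{sγ}`, `W = δ_{rβ}`, the second
covariant derivatives of `X` differ from `∇_V ∇_W X - ∇_W ∇_V X` by connection coefficients times
first covariant derivatives.  Writing the commutator as curvature plus `∇_[V,W] X` and expanding
`[V,W]` in the adapted basis, the first order terms assemble to the components of the torsion of
`(V, W)` along `δ_{0σ}`, `δ_{1σ}`, `δ_{2σ}`, contracted with the deflection tensors
(`ricci_identity`).  A torsion component off the two directions is a bracket coefficient, and the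
bracket coefficients missing from the formulas vanish because the leading components of the adapted
basis fields are constant (`lieBracket_fst`, `lieBracket_snd_fst`, `lieBracket_basis_two`).

The identity holds for every nonlinear connection and every N-linear connection with smooth
coefficients, since it uses only the product rule and the symmetry of second derivatives.  What is
specific to the submanifold is thus the smoothness of the induced objects
(`smoothOn_inducedNonlinear`, `contDiffOn_inducedTangent`).  The fundamental tensor is smooth and
positive definite off the zero section, which makes the Finsler connections smooth.  The frame of
normals is arbitrary, possibly discontinuous, but the induced connections depend only on the
tangential projection `(ᵗB g B)⁻¹ ᵗB g` (`cotangent_eq`, `contDiffOn_normal_tensorK`).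
-/

noncomputable section

namespace Osc2

variable {k : ℕ}

/-! ### The adapted basis and its dual -/

lemma cobasis_basis (N : NonlinearConnection k) (t r : Fin 3) (σ β : Fin k) (p : Osc k) :
    cobasis N t σ p (basis N r β p) = if t = r ∧ σ = β then 1 else 0 := by
  fin_cases t <;> fin_cases r <;>
    simp [cobasis, basis, nat, bas, Prod.fst_sum, Prod.snd_sum, Matrix.mul_apply, Finset.sum_apply,
      Pi.single_apply, Finset.sum_ite_eq, Finset.sum_ite_eq']
  rw [sub_add_eq_add_sub, sub_add_cancel, add_neg_cancel]

/-- Every vector is the combination of the adapted basis with its values under the adapted cobasis. -/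
lemma sum_cobasis_smul_basis (N : NonlinearConnection k) (p w : Osc k) :
    ∑ t, ∑ σ, cobasis N t σ p w • basis N t σ p = w := by
  rw [Fin.sum_univ_three]
  refine Prod.ext ?_ (Prod.ext ?_ ?_) <;> ext a <;>
    simp [cobasis, basis, nat, bas, Prod.fst_sum, Prod.snd_sum, Matrix.mul_apply, Finset.sum_apply,
      Pi.single_apply, Finset.sum_ite_eq]
  · simp only [mul_comm (w.1 _)]
    ring
  · simp only [mul_comm (w.1 _), add_mul, Finset.sum_add_distrib, sub_mul, Finset.sum_sub_distrib,
      Finset.sum_mul, mul_comm (w.2.1 _)]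
    rw [Finset.sum_comm]
    simp only [mul_comm (N.M1 p _ _ * _) (N.M1 p a _), mul_assoc]
    ring

/-- A nonlinear connection is smooth on `U` if all its dual coefficients are. -/
def NonlinearConnection.SmoothOn (N : NonlinearConnection k) (U : Set (Osc k)) : Prop :=
  (∀ a b, ContDiffOn ℝ ∞ (fun p => N.M1 p a b) U) ∧
    ∀ a b, ContDiffOn ℝ ∞ (fun p => N.M2 p a b) U

lemma NonlinearConnection.SmoothOn.basis {N : NonlinearConnection k} {U : Set (Osc k)}
    (h : N.SmoothOn U) (r : Fin 3) (a : Fin k) : ContDiffOn ℝ ∞ (basis N r a) U := by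
  have h1 := h.1
  have h2 := h.2
  have h3 : ∀ b c, ContDiffOn ℝ ∞ (fun p => (N.M2 p - N.M1 p * N.M1 p) b c) U := by
    intro b c
    simp only [Matrix.sub_apply, Matrix.mul_apply]
    fun_prop
  have h4 : ∀ b (v : Osc k), ContDiffOn ℝ ∞ (fun p => N.M1 p b a • v) U :=
    fun b v => (h1 b a).smul contDiffOn_const
  have h5 : ∀ b (v : Osc k),
      ContDiffOn ℝ ∞ (fun p => (N.M2 p - N.M1 p * N.M1 p) b a • v) U :=
    fun b v => (h3 b a).smul contDiffOn_const
  match r with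
  | 0 =>
    exact (contDiffOn_const.sub (ContDiffOn.sum fun b _ => h4 b _)).sub
      (ContDiffOn.sum fun b _ => h5 b _)
  | 1 => exact contDiffOn_const.sub (ContDiffOn.sum fun b _ => h4 b _)
  | 2 => exact contDiffOn_const

lemma contDiffOn_dir {X : Osc k → Osc k} {f : Osc k → ℝ} {U : Set (Osc k)} (hU : IsOpen U)
    (hX : ContDiffOn ℝ ∞ X U) (hf : ContDiffOn ℝ ∞ f U) : ContDiffOn ℝ ∞ (dir X f) U :=
  (hf.fderiv_of_isOpen hU (by simp)).clm_apply hX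

/-- The Lie bracket acts on functions as the commutator of derivations, by the symmetry of second
derivatives. -/
lemma dir_dir_sub {V W : Osc k → Osc k} {f : Osc k → ℝ} {U : Set (Osc k)} (hU : IsOpen U)
    (hV : ContDiffOn ℝ ∞ V U) (hW : ContDiffOn ℝ ∞ W U) (hf : ContDiffOn ℝ ∞ f U)
    {p : Osc k} (hp : p ∈ U) :
    dir V (dir W f) p - dir W (dir V f) p = dir (VectorField.lieBracket ℝ V W) f p := by
  have hd : ∀ {E : Type} [NormedAddCommGroup E] [NormedSpace ℝ E] {g : Osc k → E},
      ContDiffOn ℝ ∞ g U → DifferentiableAt ℝ g p :=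
    fun hg => (hg.contDiffAt (hU.mem_nhds hp)).differentiableAt (by simp)
  have hf' := hd (hf.fderiv_of_isOpen (m := ∞) hU (by simp))
  have hs : IsSymmSndFDerivAt ℝ f p :=
    (hf.contDiffAt (hU.mem_nhds hp)).isSymmSndFDerivAt (by
      rw [minSmoothness_of_isRCLikeNormedField]; exact WithTop.coe_le_coe.2 (le_top : (2 : ℕ∞) ≤ ⊤))
  have key : ∀ {Y : Osc k → Osc k} (v : Osc k), ContDiffOn ℝ ∞ Y U →
      fderiv ℝ (dir Y f) p v
        = fderiv ℝ (fderiv ℝ f) p v (Y p) + fderiv ℝ f p (fderiv ℝ Y p v) := by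
    intro Y v hY
    unfold dir
    rw [fderiv_clm_apply hf' (hd hY)]
    simp [add_comm]
  change fderiv ℝ (dir W f) p (V p) - fderiv ℝ (dir V f) p (W p) = fderiv ℝ f p _
  rw [key _ hW, key _ hV, VectorField.lieBracket, map_sub, hs.eq (V p) (W p)]
  ring


/-! ### Covariant derivatives along adapted fields -/

variable (N : NonlinearConnection k) (Γ : NLinear k)

lemma sum_cobasis_basis (F : Fin 3 → Fin k → ℝ) (r : Fin 3) (β : Fin k) (p : Osc k) :
    ∑ t, ∑ σ, F t σ * cobasis N t σ p (basis N r β p) = F r β := by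
  simp [cobasis_basis, ite_and, Finset.sum_ite_eq']

lemma covAlong_basis (i r : Fin 3) (β : Fin k) (X : Fin k → Osc k → ℝ) :
    covAlong N Γ i (basis N r β) X = fun α => covVec N Γ i r X α β := by
  funext α p
  simp only [covAlong, covVec, sum_cobasis_basis N (fun t σ => Γ i t α _ σ p), mul_comm]

/-- `∇_V X` is tensorial in `V`, so that it is determined by the covariant derivatives along the
adapted basis. -/
lemma covAlong_eq_sum (i : Fin 3) (V : Osc k → Osc k) (X : Fin k → Osc k → ℝ) (α : Fin k)
    (p : Osc k) :
    covAlong N Γ i V X α p = ∑ t, ∑ σ, cobasis N t σ p (V p) * covVec N Γ i t X α σ p := by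
  have h : dir V (X α) p = ∑ t, ∑ σ, cobasis N t σ p (V p) * dir (basis N t σ) (X α) p := by
    conv_lhs => rw [dir, ← sum_cobasis_smul_basis N p (V p)]
    simp [map_sum, dir]
  simp only [covAlong, covVec, h, mul_add, Finset.sum_add_distrib, Finset.mul_sum]
  congr 1
  rw [Finset.sum_comm]
  refine Finset.sum_congr rfl fun t _ => ?_
  rw [Finset.sum_comm]
  exact Finset.sum_congr rfl fun σ _ => Finset.sum_congr rfl fun γ _ => by ring

/-- The adapted basis fields have constant components, so their covariant derivatives are the
connection coefficients, placed in a single d-vector component. -/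
lemma torsCoeff_eq (i r s t : Fin 3) (σ β γ : Fin k) (p : Osc k) :
    torsCoeff N Γ i r s t σ β γ p
      = (if t = r then Γ i s σ β γ p else 0) - (if t = s then Γ i r σ γ β p else 0)
        - cobasis N t σ p (VectorField.lieBracket ℝ (basis N s γ) (basis N r β) p) := by
  simp only [torsCoeff, torsion, covAlong_basis, covVec, cobasis_basis]
  congr 2 <;> simp [dir, ite_and]

lemma covTensor_eq (i s : Fin 3) (T : Fin k → Fin k → Osc k → ℝ) (α β γ : Fin k) (p : Osc k) :
    covTensor N Γ i s T α β γ p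
      = covVec N Γ i s (fun τ => T τ β) α γ p - ∑ σ, Γ i s σ β γ p * T α σ p := rfl

variable {N Γ} {U : Set (Osc k)} {p : Osc k}

/-- The curvature is tensorial in the differentiated field: the terms with derivatives of `X`
cancel, those of second order against `∇_[V,W] X`. -/
lemma curvature_eq_sum_curvCoeff (hU : IsOpen U) (hN : N.SmoothOn U)
    (hΓ : ∀ i r α β γ, ContDiffOn ℝ ∞ (Γ i r α β γ) U) {X : Fin k → Osc k → ℝ}
    (hX : ∀ α, ContDiffOn ℝ ∞ (X α) U) (hp : p ∈ U) (i r s : Fin 3) (α β γ : Fin k) :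
    curvature N Γ i (basis N s γ) (basis N r β) X α p
      = ∑ δ, X δ p * curvCoeff N Γ i r s δ α β γ p := by
  have hd : ∀ {g : Osc k → ℝ}, ContDiffOn ℝ ∞ g U → DifferentiableAt ℝ g p :=
    fun hg => (hg.contDiffAt (hU.mem_nhds hp)).differentiableAt (by simp)
  have hΓ' := fun i r α β γ => hd (hΓ i r α β γ)
  have hX' := fun α => hd (hX α)
  have hXd := fun r β α => hd (contDiffOn_dir hU (hN.basis r β) (hX α))
  -- second covariant derivatives of an arbitrary field and of a basis field
  have h2 (r s : Fin 3) (β γ : Fin k) :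
      covVec N Γ i s (fun τ => covVec N Γ i r X τ β) α γ p
        = dir (basis N s γ) (dir (basis N r β) (X α)) p
          + ∑ σ, (dir (basis N s γ) (X σ) p * Γ i r α σ β p
            + dir (basis N r β) (X σ) p * Γ i s α σ γ p)
          + ∑ δ, X δ p * (dir (basis N s γ) (Γ i r α δ β) p
            + ∑ σ, Γ i s α σ γ p * Γ i r σ δ β p) := by
    have hdir : dir (basis N s γ) (covVec N Γ i r X α β) p
        = dir (basis N s γ) (dir (basis N r β) (X α)) p
          + ∑ σ, (Γ i r α σ β p * dir (basis N s γ) (X σ) p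
            + X σ p * dir (basis N s γ) (Γ i r α σ β) p) := by
      change fderiv ℝ (fun q => dir (basis N r β) (X α) q + ∑ σ, Γ i r α σ β q * X σ q) p
        (basis N s γ p) = _
      rw [fderiv_fun_add (hXd r β α)
        (DifferentiableAt.fun_sum fun σ _ => (hΓ' _ _ _ _ _).fun_mul (hX' σ)),
        fderiv_fun_sum fun σ _ => (hΓ' _ _ _ _ _).fun_mul (hX' σ)]
      simp only [fderiv_fun_mul (hΓ' _ _ _ _ _) (hX' _)]
      simp [dir]
    conv_lhs => rw [covVec, hdir]
    simp only [covVec, mul_add, Finset.sum_add_distrib, Finset.mul_sum]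
    rw [Finset.sum_comm (f := fun δ σ => X δ p * (Γ i s α σ γ p * Γ i r σ δ β p))]
    simp only [mul_comm, mul_left_comm]
    ring
  have he (r s : Fin 3) (β γ δ : Fin k) :
      covVec N Γ i s (fun τ => covVec N Γ i r (fun τ _ => if τ = δ then 1 else 0) τ β) α γ p
        = dir (basis N s γ) (Γ i r α δ β) p + ∑ σ, Γ i s α σ γ p * Γ i r σ δ β p := by
    have : ∀ τ, covVec N Γ i r (fun τ _ => if τ = δ then 1 else 0) τ β = Γ i r τ δ β := by
      intro τ; funext q; simp [covVec, dir]
    rw [funext this]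
    rfl
  simp only [curvCoeff, curvature, covAlong_basis, h2, he]
  have hb := dir_dir_sub hU (hN.basis s γ) (hN.basis r β) (hX α) hp
  simp only [covAlong]
  rw [← hb]
  simp only [mul_sub, mul_add, Finset.sum_add_distrib, Finset.sum_sub_distrib]
  simp [dir]
  ring

/-- The Ricci identity for a d-vector field `X`, with all three d-vector components `t` of the
torsion. -/
theorem ricci_identity (hU : IsOpen U) (hN : N.SmoothOn U)
    (hΓ : ∀ i r α β γ, ContDiffOn ℝ ∞ (Γ i r α β γ) U) {X : Fin k → Osc k → ℝ}
    (hX : ∀ α, ContDiffOn ℝ ∞ (X α) U) (hp : p ∈ U) (i r s : Fin 3) (α β γ : Fin k) :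
    covTensor N Γ i s (covVec N Γ i r X) α β γ p - covTensor N Γ i r (covVec N Γ i s X) α γ β p
      = ∑ δ, X δ p * curvCoeff N Γ i r s δ α β γ p
        - ∑ t, ∑ δ, covVec N Γ i t X α δ p * torsCoeff N Γ i r s t δ β γ p := by
  rw [← curvature_eq_sum_curvCoeff hU hN hΓ hX hp, covTensor_eq, covTensor_eq, curvature]
  rw [covAlong_eq_sum _ _ _ (VectorField.lieBracket ℝ _ _)]
  simp only [covAlong_basis, torsCoeff_eq, mul_sub, Finset.sum_sub_distrib]
  have h1 (r : Fin 3) (F : Fin k → ℝ) :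
      ∑ t, ∑ δ, covVec N Γ i t X α δ p * (if t = r then F δ else 0)
        = ∑ δ, F δ * covVec N Γ i r X α δ p := by
    simp [mul_comm]
  rw [h1 r fun δ => Γ i s δ β γ p, h1 s fun δ => Γ i r δ γ β p]
  simp only [mul_comm (cobasis _ _ _ _ _)]
  ring

/-! ### Vanishing components of brackets -/

/-- The `dx`-components of adapted basis fields are constant, so that brackets of these fields have
none. -/
lemma lieBracket_fst (hU : IsOpen U) (hN : N.SmoothOn U) (hp : p ∈ U) (r s : Fin 3)
    (β γ : Fin k) : (VectorField.lieBracket ℝ (basis N r β) (basis N s γ) p).1 = 0 := by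
  have h (r : Fin 3) (β : Fin k) (v : Osc k) : (fderiv ℝ (basis N r β) p v).1 = 0 := by
    have hd : DifferentiableAt ℝ (basis N r β) p :=
      ((hN.basis r β).contDiffAt (hU.mem_nhds hp)).differentiableAt (by simp)
    have hc : (fun q => (basis N r β q).1) = fun _ => (nat r β).1 := by
      funext q
      fin_cases r <;> simp [basis, nat, Prod.fst_sum]
    have := congrArg (fun L => L v) (fderiv.fst hd)
    simpa [hc] using this.symm
  simp [VectorField.lieBracket, h]

/-- The `dy⁽¹⁾`-components of `δ_{1a}` and `δ_{2a}` are constant. -/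
lemma lieBracket_snd_fst (hU : IsOpen U) (hN : N.SmoothOn U) (hp : p ∈ U) {r s : Fin 3}
    (hr : r ≠ 0) (hs : s ≠ 0) (β γ : Fin k) :
    (VectorField.lieBracket ℝ (basis N r β) (basis N s γ) p).2.1 = 0 := by
  have h {r : Fin 3} (hr : r ≠ 0) (β : Fin k) (v : Osc k) :
      (fderiv ℝ (basis N r β) p v).2.1 = 0 := by
    have hd : DifferentiableAt ℝ (basis N r β) p :=
      ((hN.basis r β).contDiffAt (hU.mem_nhds hp)).differentiableAt (by simp)
    have hc : (fun q => (basis N r β q).2.1) = fun _ => (nat r β).2.1 := by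
      funext q
      fin_cases r <;> simp [basis, nat, Prod.fst_sum, Prod.snd_sum] at hr ⊢
    have := congrArg (fun L => L v) (fderiv.fst hd.snd)
    simpa [hc, fderiv.snd hd] using this.symm
  simp [VectorField.lieBracket, h hr, h hs]

lemma lieBracket_basis_two (β γ : Fin k) :
    VectorField.lieBracket ℝ (basis N 2 β) (basis N 2 γ) p = 0 := by
  have h (β : Fin k) : basis N 2 β = fun _ => nat 2 β := rfl
  simp [VectorField.lieBracket, h]

lemma torsCoeff_zero (hU : IsOpen U) (hN : N.SmoothOn U) (hp : p ∈ U) (i r s : Fin 3)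
    (σ β γ : Fin k) :
    torsCoeff N Γ i r s 0 σ β γ p
      = (if 0 = r then Γ i s σ β γ p else 0) - (if 0 = s then Γ i r σ γ β p else 0) := by
  rw [torsCoeff_eq, cobasis, lieBracket_fst hU hN hp]
  simp

lemma torsCoeff_one (hU : IsOpen U) (hN : N.SmoothOn U) (hp : p ∈ U) {i r s : Fin 3}
    (hr : r ≠ 0) (hs : s ≠ 0) (σ β γ : Fin k) :
    torsCoeff N Γ i r s 1 σ β γ p
      = (if 1 = r then Γ i s σ β γ p else 0) - (if 1 = s then Γ i r σ γ β p else 0) := by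
  rw [torsCoeff_eq, cobasis, lieBracket_fst hU hN hp, lieBracket_snd_fst hU hN hp hs hr]
  simp

lemma torsCoeff_eq_bracketCoeff {i r s t : Fin 3} (hr : t ≠ r) (hs : t ≠ s) (σ β γ : Fin k) :
    torsCoeff N Γ i r s t σ β γ p = bracketCoeff N r s t σ β γ p := by
  rw [torsCoeff_eq, bracketCoeff, VectorField.lieBracket_swap, if_neg hr, if_neg hs]
  fin_cases t <;> simp [cobasis]
  all_goals ring

/-- The Ricci identity for the five types of pairs of adapted directions, with the torsion
components identified or seen to vanish. -/
theorem ricci_identities (hU : IsOpen U) (hN : N.SmoothOn U)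
    (hΓ : ∀ i r α β γ, ContDiffOn ℝ ∞ (Γ i r α β γ) U) {X : Fin k → Osc k → ℝ}
    (hX : ∀ α, ContDiffOn ℝ ∞ (X α) U) (hp : p ∈ U) (i : Fin 3) (α β γ : Fin k) :
    (covTensor N Γ i 0 (covVec N Γ i 0 X) α β γ p - covTensor N Γ i 0 (covVec N Γ i 0 X) α γ β p
      = ∑ δ, X δ p * curvR N Γ i δ α β γ p
        - ∑ δ, covVec N Γ i 0 X α δ p * torsT N Γ i δ β γ p
        - ∑ δ, covVec N Γ i 1 X α δ p * torsR N 0 1 δ β γ p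
        - ∑ δ, covVec N Γ i 2 X α δ p * torsR N 0 2 δ β γ p) ∧
    (covTensor N Γ i 1 (covVec N Γ i 0 X) α β γ p - covTensor N Γ i 0 (covVec N Γ i 1 X) α γ β p
      = ∑ δ, X δ p * curvP N Γ 1 i δ α β γ p
        - ∑ δ, covVec N Γ i 0 X α δ p * Γ i 1 δ β γ p
        - ∑ δ, covVec N Γ i 1 X α δ p * torsPdiag N Γ 1 i δ β γ p
        - ∑ δ, covVec N Γ i 2 X α δ p * torsPmixed N 1 2 δ β γ p) ∧
    (covTensor N Γ i 2 (covVec N Γ i 0 X) α β γ p - covTensor N Γ i 0 (covVec N Γ i 2 X) α γ β p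
      = ∑ δ, X δ p * curvP N Γ 2 i δ α β γ p
        - ∑ δ, covVec N Γ i 0 X α δ p * Γ i 2 δ β γ p
        - ∑ δ, covVec N Γ i 1 X α δ p * torsPmixed N 2 1 δ β γ p
        - ∑ δ, covVec N Γ i 2 X α δ p * torsPdiag N Γ 2 i δ β γ p) ∧
    (covTensor N Γ i 2 (covVec N Γ i 1 X) α β γ p - covTensor N Γ i 1 (covVec N Γ i 2 X) α γ β p
      = ∑ δ, X δ p * curvQ N Γ i δ α β γ p
        - ∑ δ, covVec N Γ i 1 X α δ p * Γ i 2 δ β γ p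
        - ∑ δ, covVec N Γ i 2 X α δ p * torsQ N Γ i δ β γ p) ∧
    (∀ l : Fin 3, l = 1 ∨ l = 2 →
      covTensor N Γ i l (covVec N Γ i l X) α β γ p - covTensor N Γ i l (covVec N Γ i l X) α γ β p
        = ∑ δ, X δ p * curvS N Γ l i δ α β γ p
          - ∑ δ, covVec N Γ i l X α δ p * torsS N Γ l i δ β γ p
          - ∑ δ, covVec N Γ i 2 X α δ p * torsR N l 2 δ β γ p) ∧
    torsR N 2 2 α β γ p = 0 := by
  have hR : ∀ α, torsR N 2 2 α β γ p = 0 := fun α => by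
    simp [torsR, bracketCoeff, lieBracket_basis_two, cobasis]
  have key := fun r s => ricci_identity hU hN hΓ hX hp i r s α β γ
  simp only [Fin.sum_univ_three, ← sub_sub] at key
  have h0 := fun r s δ => torsCoeff_zero (Γ := Γ) hU hN hp i r s δ β γ
  have h1 := fun r s hr hs δ => torsCoeff_one (Γ := Γ) hU hN hp (i := i) (r := r) (s := s) hr hs δ β γ
  have hb := fun r s t hr hs δ =>
    torsCoeff_eq_bracketCoeff (N := N) (Γ := Γ) (p := p) (i := i) (r := r) (s := s) (t := t) hr hs δ β γ
  refine ⟨?_, ?_, ?_, ?_, ?_, hR α⟩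
  · rw [key 0 0]
    simp only [hb 0 0 1 (by decide) (by decide), hb 0 0 2 (by decide) (by decide)]
    rfl
  · rw [key 0 1]
    simp only [h0 0 1, hb 0 1 2 (by decide) (by decide)]
    simp [curvP, torsPdiag, torsPmixed]
  · rw [key 0 2]
    simp only [h0 0 2, hb 0 2 1 (by decide) (by decide)]
    simp [curvP, torsPdiag, torsPmixed]
  · rw [key 1 2]
    simp only [h0 1 2, h1 1 2 (by decide) (by decide)]
    simp [curvQ, torsQ]
  · rintro l (rfl | rfl)
    · rw [key 1 1]
      simp only [h0 1 1, hb 1 1 2 (by decide) (by decide)]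
      simp [curvS, torsS, torsR]
    · rw [key 2 2]
      simp only [h0 2 2, h1 2 2 (by decide) (by decide), hR]
      simp [curvS, torsS]

/-! ### Smoothness of inverse matrices and of derivatives with parameters -/

section Matrices

variable {E : Type*} [NormedAddCommGroup E] [NormedSpace ℝ E] {U : Set E}

lemma contDiffOn_det {k : ℕ} {A : E → Matrix (Fin k) (Fin k) ℝ}
    (hA : ∀ a b, ContDiffOn ℝ ∞ (fun p => A p a b) U) :
    ContDiffOn ℝ ∞ (fun p => (A p).det) U := by
  simp only [Matrix.det_apply]
  exact ContDiffOn.sum fun σ _ => (contDiffOn_prod fun i _ => hA _ _).const_smul _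

lemma contDiffOn_matrix_inv {k : ℕ} {A : E → Matrix (Fin k) (Fin k) ℝ}
    (hA : ∀ a b, ContDiffOn ℝ ∞ (fun p => A p a b) U) (hdet : ∀ p ∈ U, (A p).det ≠ 0)
    (a b : Fin k) : ContDiffOn ℝ ∞ (fun p => (A p)⁻¹ a b) U := by
  simp only [Matrix.inv_def, Ring.inverse_eq_inv', Matrix.smul_apply, smul_eq_mul,
    Matrix.adjugate_apply]
  refine ((contDiffOn_det hA).inv hdet).mul (contDiffOn_det fun c d => ?_)
  by_cases h : c = b
  · subst h
    simpa using contDiffOn_const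
  · simpa [h] using hA c d

lemma contDiffOn_matrix_mul {k l o : ℕ} {A : E → Matrix (Fin k) (Fin l) ℝ}
    {B : E → Matrix (Fin l) (Fin o) ℝ}
    (hA : ∀ a b, ContDiffOn ℝ ∞ (fun p => A p a b) U)
    (hB : ∀ a b, ContDiffOn ℝ ∞ (fun p => B p a b) U) (a : Fin k) (b : Fin o) :
    ContDiffOn ℝ ∞ (fun p => (A p * B p) a b) U := by
  simp only [Matrix.mul_apply]
  exact ContDiffOn.sum fun c _ => (hA a c).mul (hB c b)

lemma det_ne_zero_of_forall_dotProduct_pos {k : ℕ} {A : Matrix (Fin k) (Fin k) ℝ}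
    (h : ∀ w, w ≠ 0 → 0 < w ⬝ᵥ A.mulVec w) : A.det ≠ 0 := by
  intro hA
  obtain ⟨w, hw, hAw⟩ := Matrix.exists_mulVec_eq_zero_iff.2 hA
  simpa [hAw] using h w hw

/-- Smoothness of `p ↦ D(f p)(g p)`, for a function `f p` that depends on `p`. -/
lemma contDiffOn_fderiv_param {F G : Type*} [NormedAddCommGroup F] [NormedSpace ℝ F]
    [NormedAddCommGroup G] [NormedSpace ℝ G] {f : E → F → G} {g : E → F}
    (hf : ∀ p ∈ U, ContDiffAt ℝ ∞ (Function.uncurry f) (p, g p)) (hg : ContDiffOn ℝ ∞ g U)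
    (hU : IsOpen U) : ContDiffOn ℝ ∞ (fun p => fderiv ℝ (f p) (g p)) U := fun p hp =>
  (ContDiffAt.fderiv (hf p hp) (hg.contDiffAt (hU.mem_nhds hp)) (by simp)).contDiffWithinAt

end Matrices

lemma contDiffOn_cobasis {k : ℕ} {N : NonlinearConnection k} {U : Set (Osc k)}
    (hN : N.SmoothOn U) {E : Type*} [NormedAddCommGroup E] [NormedSpace ℝ E] {V : Set E}
    {h w : E → Osc k} (hh : ContDiffOn ℝ ∞ h V) (hw : ContDiffOn ℝ ∞ w V) (hm : V.MapsTo h U)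
    (r : Fin 3) (a : Fin k) : ContDiffOn ℝ ∞ (fun p => cobasis N r a (h p) (w p)) V := by
  have h1 := fun b => (hN.1 a b).comp hh hm
  have h2 := fun b => (hN.2 a b).comp hh hm
  simp only [Function.comp_def] at h1 h2
  fin_cases r <;> simp only [cobasis] <;> fun_prop

lemma contDiffOn_bracketCoeff {k : ℕ} {N : NonlinearConnection k} {U : Set (Osc k)}
    (hU : IsOpen U) (hN : N.SmoothOn U) (r s t : Fin 3) (σ β γ : Fin k) :
    ContDiffOn ℝ ∞ (bracketCoeff N r s t σ β γ) U := by
  have h := hN.basis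
  exact contDiffOn_cobasis hN contDiffOn_id
    ((((h s γ).fderiv_of_isOpen hU (by simp)).clm_apply (h r β)).sub
      (((h r β).fderiv_of_isOpen hU (by simp)).clm_apply (h s γ))) (Set.mapsTo_id U) t σ

/-! ### Smoothness of the connections of a Finsler space -/

section Finsler

variable {k : ℕ} {Φ : Crd k → Crd k → ℝ} {D : Set (Crd k × Crd k)}

lemma contDiffOn_fundTensor (hD : IsOpen D)
    (hΦ : ContDiffOn ℝ ∞ (fun q : Crd k × Crd k => Φ q.1 q.2) D) (a b : Fin k) :
    ContDiffOn ℝ ∞ (fun q => fundTensor Φ q a b) {q : Osc k | (q.1, q.2.1) ∈ D} := by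
  have h1 : ContDiffOn ℝ ∞ (fun q : Crd k × Crd k =>
      fderiv ℝ (fun y' => Φ q.1 y' ^ 2) q.2 (bas b)) D := by
    refine (contDiffOn_fderiv_param (f := fun (q : Crd k × Crd k) y' => Φ q.1 y' ^ 2)
      (fun q hq => ?_) contDiffOn_snd hD).clm_apply contDiffOn_const
    have h := (hΦ.contDiffAt (hD.mem_nhds hq)).pow 2
    exact h.comp (f := fun z : (Crd k × Crd k) × Crd k => (z.1.1, z.2)) (q, q.2)
      (by fun_prop)
  have hU : IsOpen {q : Osc k | (q.1, q.2.1) ∈ D} := hD.preimage (by fun_prop)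
  refine contDiffOn_const.mul ((contDiffOn_fderiv_param
    (f := fun (q : Osc k) y => fderiv ℝ (fun y' => Φ q.1 y' ^ 2) y (bas b))
    (g := fun q => q.2.1) (fun q hq => ?_) (by fun_prop) hU).clm_apply contDiffOn_const)
  exact (h1.contDiffAt (hD.mem_nhds hq)).comp
    (f := fun z : Osc k × Crd k => (z.1.1, z.2)) (q, q.2.1) (by fun_prop)

variable {U : Set (Osc k)}

lemma contDiffOn_christoffel (hU : IsOpen U)
    (hg : ∀ a b, ContDiffOn ℝ ∞ (fun q => fundTensor Φ q a b) U)
    (hdet : ∀ q ∈ U, (fundTensor Φ q).det ≠ 0) (a b c : Fin k) :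
    ContDiffOn ℝ ∞ (christoffel Φ a b c) U := by
  have h1 := contDiffOn_matrix_inv hg hdet
  have h2 := fun (v : Osc k) a b => contDiffOn_dir hU (contDiffOn_const (c := v)) (hg a b)
  exact contDiffOn_const.mul (ContDiffOn.sum fun d _ =>
    (h1 a d).mul (((h2 _ d c).add (h2 _ b d)).sub (h2 _ b c)))

lemma contDiffOn_cartanM1 (hU : IsOpen U)
    (hg : ∀ a b, ContDiffOn ℝ ∞ (fun q => fundTensor Φ q a b) U)
    (hdet : ∀ q ∈ U, (fundTensor Φ q).det ≠ 0) (a b : Fin k) :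
    ContDiffOn ℝ ∞ (fun q => cartanM1 Φ q a b) U := by
  have h1 := contDiffOn_christoffel hU hg hdet
  refine contDiffOn_dir hU contDiffOn_const ?_
  unfold spray
  fun_prop

lemma smoothOn_finslerConnection (hU : IsOpen U)
    (hg : ∀ a b, ContDiffOn ℝ ∞ (fun q => fundTensor Φ q a b) U)
    (hdet : ∀ q ∈ U, (fundTensor Φ q).det ≠ 0) : (finslerConnection Φ).SmoothOn U := by
  have h1 := contDiffOn_cartanM1 hU hg hdet
  refine ⟨h1, fun a b => contDiffOn_const.mul
    ((contDiffOn_dir hU (by fun_prop) (h1 a b)).add ?_)⟩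
  fun_prop

lemma contDiffOn_canonicalConnection (hU : IsOpen U)
    (hg : ∀ a b, ContDiffOn ℝ ∞ (fun q => fundTensor Φ q a b) U)
    (hdet : ∀ q ∈ U, (fundTensor Φ q).det ≠ 0) (i r : Fin 3) (a b c : Fin k) :
    ContDiffOn ℝ ∞ (canonicalConnection Φ i r a b c) U := by
  have hN := smoothOn_finslerConnection hU hg hdet
  have h1 := contDiffOn_matrix_inv hg hdet
  have h2 := fun r c a b => contDiffOn_dir hU (hN.basis r c) (hg a b)
  have h3 := contDiffOn_bracketCoeff hU hN
  unfold canonicalConnection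
  by_cases hr : r = i
  · simp only [if_pos hr]
    exact contDiffOn_const.mul (ContDiffOn.sum fun d _ =>
      (h1 a d).mul (((h2 i b d c).add (h2 i c b d)).sub (h2 i d b c)))
  · by_cases h0 : r = 0
    · simp only [if_neg hr, if_pos h0]
      exact (h3 0 i i a c b).add (contDiffOn_const.mul (ContDiffOn.sum fun d _ =>
        (h1 a d).mul (((h2 0 c b d).sub
          (ContDiffOn.sum fun f _ => (h3 0 i i f c b).mul (hg f d))).sub
          (ContDiffOn.sum fun f _ => (h3 0 i i f c d).mul (hg b f)))))
    · simp only [if_neg hr, if_neg h0]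
      exact contDiffOn_const.mul (ContDiffOn.sum fun d _ => (h1 a d).mul (h2 r c b d))

end Finsler

/-! ### Smoothness of the induced connections -/

section Submanifold

variable {m n : ℕ} {Φ : Crd n → Crd n → ℝ} {x : Crd m → Crd n} {R : MovingFrame m n}

section Immersion

variable {T : Set (Crd m)} (hT : IsOpen T) (hx : ContDiffOn ℝ ∞ x T)
include hT hx

lemma contDiffOn_oscMap : ContDiffOn ℝ ∞ (oscMap x) {p | p.1 ∈ T} := by
  have hV : IsOpen {p : Osc m | p.1 ∈ T} := hT.preimage continuous_fst
  have h1 := hx.fderiv_of_isOpen hT (m := ∞) (by simp)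
  have hm : Set.MapsTo (fun p : Osc m => p.1) {p | p.1 ∈ T} T := fun p hp => hp
  have h2 := h1.comp contDiffOn_fst hm
  refine (hx.comp contDiffOn_fst hm).prodMk ((h2.clm_apply (by fun_prop)).prodMk
    (((ContDiffOn.clm_apply (contDiffOn_fderiv_param
      (f := fun (p : Osc m) u => fderiv ℝ x u p.2.1) (g := fun p => p.1) (fun p hp => ?_)
      (by fun_prop) hV) (by fun_prop)).const_smul _).add (h2.clm_apply (by fun_prop))))
  exact ((h1.contDiffAt (hT.mem_nhds hp)).comp (f := fun z : Osc m × Crd m => z.2) (p, p.1)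
    (by fun_prop)).clm_apply (by fun_prop)

lemma contDiffOn_tangentB (a : Fin n) (α : Fin m) :
    ContDiffOn ℝ ∞ (fun u => tangentB x u a α) T := by
  have h := (hx.fderiv_of_isOpen hT (m := ∞) (by simp)).clm_apply (contDiffOn_const (c := bas α))
  simp only [tangentB, Matrix.of_apply]
  fun_prop

lemma contDiffOn_secondB (a : Fin n) (α β : Fin m) : ContDiffOn ℝ ∞ (secondB x a α β) T :=
  ((contDiffOn_tangentB hT hx a α).fderiv_of_isOpen hT (by simp)).clm_apply contDiffOn_const

end Immersion

/-- The tangential part of the dual frame is `(ᵗB g B)⁻¹ ᵗB g`, which does not involve the normals. -/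
lemma cotangent_eq {p : Osc m} (h : R.IsAdapted Φ x p)
    (hdet : ((tangentB x p.1).transpose * fundTensor Φ (oscMap x p) * tangentB x p.1).det ≠ 0) :
    R.cotangent p = ((tangentB x p.1).transpose * fundTensor Φ (oscMap x p) * tangentB x p.1)⁻¹
      * ((tangentB x p.1).transpose * fundTensor Φ (oscMap x p)) := by
  have h1 : (tangentB x p.1).transpose * fundTensor Φ (oscMap x p)
      = (tangentB x p.1).transpose * fundTensor Φ (oscMap x p) * tangentB x p.1
        * R.cotangent p := by
    conv_lhs => rw [← Matrix.mul_one (_ * _), ← h.complete, Matrix.mul_add, ← Matrix.mul_assoc,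
      ← Matrix.mul_assoc _ (R.normal p), h.orthogonal, Matrix.zero_mul, add_zero]
  conv_rhs => arg 2; rw [h1]
  rw [Matrix.nonsing_inv_mul_cancel_left _ _ (Ne.isUnit hdet)]

/-- The induced metric `ᵗB g B` is positive definite, since the tangential frame is injective. -/
lemma det_inducedMetric_ne_zero {p : Osc m} (h : R.IsAdapted Φ x p)
    (hpos : ∀ w, w ≠ 0 → 0 < w ⬝ᵥ (fundTensor Φ (oscMap x p)).mulVec w) :
    ((tangentB x p.1).transpose * fundTensor Φ (oscMap x p) * tangentB x p.1).det ≠ 0 := by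
  refine det_ne_zero_of_forall_dotProduct_pos fun w hw => ?_
  have hB : (tangentB x p.1).mulVec w ≠ 0 := fun h0 => hw <| by
    rw [← Matrix.one_mulVec w, ← h.cotangent_tangent, ← Matrix.mulVec_mulVec, h0,
      Matrix.mulVec_zero]
  have := hpos _ hB
  rwa [← Matrix.mulVec_mulVec, ← Matrix.mulVec_mulVec, Matrix.dotProduct_mulVec,
    Matrix.vecMul_transpose]

section Induced

variable {Ω : Set (Osc m)} {U : Set (Osc n)} (hΩ : IsOpen Ω) (hU : IsOpen U)
  (hosc : ContDiffOn ℝ ∞ (oscMap x) Ω) (hmaps : Set.MapsTo (oscMap x) Ω U)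
  (hB : ∀ a α, ContDiffOn ℝ ∞ (fun p : Osc m => tangentB x p.1 a α) Ω)
  (hg : ∀ a b, ContDiffOn ℝ ∞ (fun q => fundTensor Φ q a b) U)
  (hpos : ∀ q ∈ U, ∀ w, w ≠ 0 → 0 < w ⬝ᵥ (fundTensor Φ q).mulVec w)
  (hR : ∀ p ∈ Ω, R.IsAdapted Φ x p)

include hosc hmaps hB hg hpos hR in
lemma contDiffOn_cotangent (α : Fin m) (a : Fin n) :
    ContDiffOn ℝ ∞ (fun p => R.cotangent p α a) Ω := by
  have hdet := fun p hp => det_inducedMetric_ne_zero (hR p hp) (hpos _ (hmaps hp))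
  have hg' := fun a b => (hg a b).comp hosc hmaps
  have h1 := contDiffOn_matrix_mul (A := fun p : Osc m => (tangentB x p.1).transpose)
    (fun a b => hB b a) hg'
  refine (contDiffOn_matrix_mul (contDiffOn_matrix_inv (contDiffOn_matrix_mul h1 hB) hdet) h1
    α a).congr fun p hp => ?_
  rw [cotangent_eq (hR p hp) (hdet p hp)]
  rfl

include hΩ hU hosc hmaps hg hpos in
lemma contDiffOn_restrictedCobasis {w : Osc m → Osc m} (hw : ContDiffOn ℝ ∞ w Ω) (r : Fin 3)
    (a : Fin n) : ContDiffOn ℝ ∞ (fun p => restrictedCobasis Φ x r a p (w p)) Ω :=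
  contDiffOn_cobasis (smoothOn_finslerConnection hU hg fun q hq =>
    det_ne_zero_of_forall_dotProduct_pos (hpos q hq)) hosc
    ((hosc.fderiv_of_isOpen hΩ (by simp)).clm_apply hw) hmaps r a

include hΩ hU hosc hmaps hB hg hpos hR

lemma smoothOn_inducedNonlinear : (inducedNonlinear Φ x R).SmoothOn Ω := by
  have h1 := contDiffOn_cotangent hosc hmaps hB hg hpos hR
  have h2 := fun (v : Osc m) => contDiffOn_restrictedCobasis hΩ hU hosc hmaps hg hpos
    (contDiffOn_const (c := v))
  constructor <;> intro a b <;> simp only [inducedNonlinear, Matrix.of_apply] <;> fun_prop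

/-- The normals `B_ᾱ` are not assumed to depend smoothly on the point, but `K` enters the coupling
only through `B_ᾱ K^ᾱ`, and `B_ᾱ B^ᾱ = 1 - B_α Bᵅ` is smooth. -/
lemma contDiffOn_normal_tensorK (r : Fin 3) (d : Fin n) (δ : Fin m) :
    ContDiffOn ℝ ∞ (fun p => ∑ δ', R.normal p d δ' * tensorK Φ x R r δ' δ p) Ω := by
  have h1 := contDiffOn_cotangent hosc hmaps hB hg hpos hR
  have h2 := fun a => contDiffOn_restrictedCobasis hΩ hU hosc hmaps hg hpos
    ((smoothOn_inducedNonlinear hΩ hU hosc hmaps hB hg hpos hR).basis 0 δ) r a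
  have h3 := contDiffOn_matrix_mul hB h1
  have h4 : ContDiffOn ℝ ∞ (fun p => ∑ a,
      ((1 : Matrix (Fin n) (Fin n) ℝ) d a - (tangentB x p.1 * R.cotangent p) d a)
        * restrictedCobasis Φ x r a p (basis (inducedNonlinear Φ x R) 0 δ p)) Ω :=
    ContDiffOn.sum fun a _ => (contDiffOn_const.sub (h3 d a)).mul (h2 a)
  refine h4.congr fun p hp => ?_
  have h5 : R.normal p * R.conormal p = 1 - tangentB x p.1 * R.cotangent p :=
    eq_sub_of_add_eq' (hR p hp).complete
  have h6 (a : Fin n) : (1 : Matrix (Fin n) (Fin n) ℝ) d a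
      - (tangentB x p.1 * R.cotangent p) d a = ∑ δ', R.normal p d δ' * R.conormal p δ' a := by
    rw [← Matrix.mul_apply, h5, Matrix.sub_apply]
  simp only [h6, tensorK, Finset.mul_sum, Finset.sum_mul]
  rw [Finset.sum_comm]
  simp only [mul_assoc]

lemma contDiffOn_coupling (i r : Fin 3) (a b : Fin n) (δ : Fin m) :
    ContDiffOn ℝ ∞ (coupling Φ x R i r a b δ) Ω := by
  have h1 := contDiffOn_normal_tensorK hΩ hU hosc hmaps hB hg hpos hR
  have h2 := fun i r a b c => (contDiffOn_canonicalConnection hU hg (fun q hq =>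
    det_ne_zero_of_forall_dotProduct_pos (hpos q hq)) i r a b c).comp hosc hmaps
  simp only [Function.comp_def] at h2
  fin_cases r <;> unfold coupling <;> simp only <;> fun_prop

lemma contDiffOn_inducedTangent
    (hB2 : ∀ a α β, ContDiffOn ℝ ∞ (fun p : Osc m => secondB x a α β p.1) Ω)
    (i r : Fin 3) (α β δ : Fin m) : ContDiffOn ℝ ∞ (inducedTangent Φ x R i r α β δ) Ω := by
  have h1 := contDiffOn_cotangent hosc hmaps hB hg hpos hR
  have h2 := contDiffOn_coupling hΩ hU hosc hmaps hB hg hpos hR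
  fin_cases r <;> unfold inducedTangent <;> simp only <;> fun_prop

end Induced

end Submanifold

lemma contDiffOn_liouville {k : ℕ} {N : NonlinearConnection k} {U : Set (Osc k)}
    (hN : N.SmoothOn U) (j : Fin 2) (α : Fin k) : ContDiffOn ℝ ∞ (liouville N j α) U := by
  have h1 := hN.1
  fin_cases j <;> unfold liouville <;> simp only <;> fun_prop

/-! ### The fundamental tensor as a Hessian -/

section Hessian

variable {E : Type*} [NormedAddCommGroup E] [NormedSpace ℝ E] {f : E → ℝ} {y : E}

lemma fderiv_fderiv_apply (hf : ContDiffAt ℝ ∞ f y) (v w : E) :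
    fderiv ℝ (fun z => fderiv ℝ f z v) y w = fderiv ℝ (fderiv ℝ f) y w v := by
  have h : DifferentiableAt ℝ (fderiv ℝ f) y :=
    (hf.fderiv_right (m := ∞) (by simp)).differentiableAt (by simp)
  rw [fderiv_clm_apply h (differentiableAt_const v)]
  simp

lemma iteratedDeriv_two_line (hf : ContDiffAt ℝ ∞ f y) (w : E) :
    iteratedDeriv 2 (fun t : ℝ => f (y + t • w)) 0 = fderiv ℝ (fderiv ℝ f) y w w := by
  have hl (t : ℝ) : HasDerivAt (fun t : ℝ => y + t • w) w t := by
    simpa using ((hasDerivAt_id t).smul_const w).const_add y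
  have hy : y + (0 : ℝ) • w = y := by simp
  have h1 : deriv (fun t : ℝ => f (y + t • w)) =ᶠ[nhds 0] fun t => fderiv ℝ f (y + t • w) w := by
    have he : ∀ᶠ z in nhds (y + (0 : ℝ) • w), ContDiffAt ℝ 1 f z := by
      rw [hy]
      exact (hf.of_le (by simp)).eventually (by simp)
    filter_upwards [(hl 0).continuousAt.eventually he] with t ht
    exact ((ht.differentiableAt (by simp)).hasFDerivAt.comp_hasDerivAt t (hl t)).deriv
  have h2 : DifferentiableAt ℝ (fun z => fderiv ℝ f z w) (y + (0 : ℝ) • w) := by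
    rw [hy]
    exact ((hf.fderiv_right (m := ∞) (by simp)).differentiableAt (by simp)).clm_apply
      (differentiableAt_const w)
  rw [iteratedDeriv_succ, iteratedDeriv_one, h1.deriv_eq]
  exact (h2.hasFDerivAt.comp_hasDerivAt (0 : ℝ) (hl 0)).deriv.trans
    (by rw [hy, fderiv_fderiv_apply hf])

end Hessian

/-- The quadratic form of the fundamental tensor is half the second derivative of `F²` along lines. -/
lemma dotProduct_fundTensor_mulVec {k : ℕ} {Φ : Crd k → Crd k → ℝ} {q : Osc k}
    (hΦ : ContDiffAt ℝ ∞ (fun y => Φ q.1 y ^ 2) q.2.1) (w : Crd k) :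
    w.ofLp ⬝ᵥ (fundTensor Φ q).mulVec w.ofLp
      = (1 / 2) * iteratedDeriv 2 (fun t : ℝ => Φ q.1 (q.2.1 + t • w) ^ 2) 0 := by
  rw [iteratedDeriv_two_line hΦ]
  have hw : w = ∑ a, w a • (bas a : Crd k) := by
    ext b
    simp [bas, Finset.sum_apply, Pi.single_apply]
  conv_rhs => rw [hw]
  simp only [dotProduct, Matrix.mulVec, fundTensor, Matrix.of_apply, fderiv_fderiv_apply hΦ,
    map_sum, map_smul, sum_apply, FunLike.coe_smul, Pi.smul_apply,
    smul_eq_mul, Finset.mul_sum]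
  rw [Finset.sum_comm]
  exact Finset.sum_congr rfl fun a _ => Finset.sum_congr rfl fun b _ => by ring

/-! ### Smoothness and positivity in charts -/

section Manifold

variable {n : ℕ} {M : Type*} [TopologicalSpace M] [ChartedSpace (Crd n) M]
  [IsManifold (𝓡 n) ∞ M] {ψ : OpenPartialHomeomorph M (Crd n)}

omit [IsManifold (𝓡 n) ∞ M] in
lemma mdifferentiable_of_mem_maximalAtlas (hψ : ψ ∈ IsManifold.maximalAtlas (𝓡 n) ∞ M) :
    ψ.MDifferentiable (𝓡 n) (𝓡 n) :=
  ⟨(contMDiffOn_of_mem_maximalAtlas hψ).mdifferentiableOn (by simp),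
    (contMDiffOn_symm_of_mem_maximalAtlas hψ).mdifferentiableOn (by simp)⟩

omit [IsManifold (𝓡 n) ∞ M] in
lemma mfderiv_symm_injective (hψ : ψ ∈ IsManifold.maximalAtlas (𝓡 n) ∞ M) {x : Crd n}
    (hx : x ∈ ψ.target) : Function.Injective (mfderiv (𝓡 n) (𝓡 n) ψ.symm x) :=
  (mdifferentiable_of_mem_maximalAtlas hψ).symm.mfderiv_injective (x := x) hx

omit [ChartedSpace (Crd n) M] [IsManifold (𝓡 n) ∞ M] in
lemma isOpen_slit (ψ : OpenPartialHomeomorph M (Crd n)) :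
    IsOpen {q : Crd n × Crd n | q.1 ∈ ψ.target ∧ q.2 ≠ 0} :=
  (ψ.open_target.preimage continuous_fst).inter (isOpen_ne.preimage continuous_snd)

/-- In a chart `F` is smooth off the zero section: it is the composition of `F` with the tangent map
of the inverse chart, which preserves non-zero vectors. -/
lemma contDiffOn_chartFinsler {F : TangentBundle (𝓡 n) M → ℝ} (hF : IsFinsler F)
    (hψ : ψ ∈ IsManifold.maximalAtlas (𝓡 n) ∞ M) :
    ContDiffOn ℝ ∞ (fun q : Crd n × Crd n => chartFinsler F ψ q.1 q.2)
      {q | q.1 ∈ ψ.target ∧ q.2 ≠ 0} := by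
  have : IsManifold (𝓡 n) 1 M := IsManifold.of_le (n := ∞) (by simp)
  have h1 := (contMDiffOn_symm_of_mem_maximalAtlas hψ).contMDiffOn_tangentMapWithin (m := ∞)
    (by simp) ψ.open_target.uniqueMDiffOn
  have h2 := (contMDiff_tangentBundleModelSpaceHomeomorph_symm (n := ∞) (I := 𝓡 n))
  have h3 : ContMDiffOn (𝓡 n).tangent 𝓘(ℝ, ℝ) ∞
      (fun q : ModelProd (Crd n) (Crd n) => chartFinsler F ψ q.1 q.2)
      {q | q.1 ∈ ψ.target ∧ q.2 ≠ 0} := by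
    have h4 := h1.comp h2.contMDiffOn
      (s := {q : ModelProd (Crd n) (Crd n) | q.1 ∈ ψ.target ∧ q.2 ≠ 0})
      fun q hq => hq.1
    have h5 : ∀ q : ModelProd (Crd n) (Crd n), q.1 ∈ ψ.target →
        tangentMapWithin (𝓡 n) (𝓡 n) ψ.symm ψ.target
          ((tangentBundleModelSpaceHomeomorph (𝓡 n)).symm q)
          = ⟨ψ.symm q.1, mfderiv (𝓡 n) (𝓡 n) ψ.symm q.1 q.2⟩ := by
      intro q hq
      exact tangentMapWithin_eq_tangentMap
        (p := (tangentBundleModelSpaceHomeomorph (𝓡 n)).symm q)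
        (ψ.open_target.uniqueMDiffOn q.1 hq)
        ((mdifferentiable_of_mem_maximalAtlas hψ).symm.mdifferentiableAt (x := q.1) hq)
    refine (hF.smooth.comp h4 fun q hq => ?_).congr fun q hq => ?_
    · change (tangentMapWithin (𝓡 n) (𝓡 n) ψ.symm ψ.target
          ((tangentBundleModelSpaceHomeomorph (𝓡 n)).symm q)).2 ≠ 0
      rw [h5 q hq.1]
      exact fun h0 => hq.2 (mfderiv_symm_injective hψ hq.1 (h0.trans (map_zero _).symm))
    · exact (congrArg F (h5 q hq.1)).symm
  rw [← contMDiffOn_iff_contDiffOn, modelWithCornersSelf_prod]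
  exact h3

lemma fundTensor_chartFinsler_pos {F : TangentBundle (𝓡 n) M → ℝ} (hF : IsFinsler F)
    (hψ : ψ ∈ IsManifold.maximalAtlas (𝓡 n) ∞ M) {q : Osc n} (hq : q.1 ∈ ψ.target)
    (hq0 : q.2.1 ≠ 0) (w : Fin n → ℝ) (hw : w ≠ 0) :
    0 < w ⬝ᵥ (fundTensor (chartFinsler F ψ) q).mulVec w := by
  have hs : ContDiffAt ℝ ∞ (fun y => chartFinsler F ψ q.1 y ^ 2) q.2.1 :=
    (((contDiffOn_chartFinsler hF hψ).contDiffAt ((isOpen_slit ψ).mem_nhds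
      (x := (q.1, q.2.1)) ⟨hq, hq0⟩)).comp (f := fun y : Crd n => (q.1, y)) q.2.1
      (by fun_prop)).pow 2
  have h := dotProduct_fundTensor_mulVec hs (WithLp.toLp 2 w)
  rw [show (WithLp.toLp 2 w).ofLp = w from rfl] at h
  rw [h]
  have hinj := mfderiv_symm_injective hψ hq
  have hne : ∀ v : Crd n, v ≠ 0 → mfderiv (𝓡 n) (𝓡 n) ψ.symm q.1 v ≠ 0 :=
    fun v hv h0 => hv (hinj (h0.trans (map_zero _).symm))
  have hpos := hF.posDef (ψ.symm q.1) _ _ (hne q.2.1 hq0) (hne (WithLp.toLp 2 w) fun h0 => hw <| by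
    simpa using congrArg WithLp.ofLp h0)
  refine mul_pos (by norm_num) (lt_of_lt_of_eq hpos ?_)
  congr 1
  funext t
  have hlin : mfderiv (𝓡 n) (𝓡 n) ψ.symm q.1 q.2.1
      + t • mfderiv (𝓡 n) (𝓡 n) ψ.symm q.1 (WithLp.toLp 2 w)
      = mfderiv (𝓡 n) (𝓡 n) ψ.symm q.1 (q.2.1 + t • WithLp.toLp 2 w) :=
    (((mfderiv (𝓡 n) (𝓡 n) ψ.symm q.1).map_add _ _).trans
      (congrArg _ ((mfderiv (𝓡 n) (𝓡 n) ψ.symm q.1).map_smul t _))).symm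
  exact congrArg (fun z => F ⟨ψ.symm q.1, z⟩ ^ 2) hlin

variable {m : ℕ} {M' : Type*} [TopologicalSpace M'] [ChartedSpace (Crd m) M']
  {f : M' → M} {φ : OpenPartialHomeomorph M' (Crd m)}

omit [IsManifold (𝓡 n) ∞ M] in
lemma contDiffOn_chartMap (hf : ContMDiff (𝓡 m) (𝓡 n) ∞ f)
    (hφ : φ ∈ IsManifold.maximalAtlas (𝓡 m) ∞ M')
    (hψ : ψ ∈ IsManifold.maximalAtlas (𝓡 n) ∞ M) :
    ContDiffOn ℝ ∞ (chartMap f φ ψ) {u | u ∈ φ.target ∧ f (φ.symm u) ∈ ψ.source} := by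
  rw [← contMDiffOn_iff_contDiffOn]
  exact (contMDiffOn_of_mem_maximalAtlas hψ).comp
    (hf.comp_contMDiffOn ((contMDiffOn_symm_of_mem_maximalAtlas hφ).mono fun u hu => hu.1))
    fun u hu => hu.2

omit [ChartedSpace (Crd n) M] [IsManifold (𝓡 n) ∞ M] [ChartedSpace (Crd m) M'] in
lemma isOpen_chartMap_domain (hf : Continuous f) :
    IsOpen {u | u ∈ φ.target ∧ f (φ.symm u) ∈ ψ.source} :=
  (hf.comp_continuousOn φ.continuousOn_symm).isOpen_inter_preimage φ.open_target ψ.open_source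

end Manifold

/-- The tangential frame is injective, so that the slit domain is mapped to points where the
fundamental tensor is smooth. -/
lemma oscMap_velocity_ne_zero {m n : ℕ} {Φ : Crd n → Crd n → ℝ} {x : Crd m → Crd n}
    {R : MovingFrame m n} {p : Osc m} (h : R.IsAdapted Φ x p) (hp : p.2.1 ≠ 0) :
    (oscMap x p).2.1 ≠ 0 := by
  intro h0
  have hv : p.2.1 = ∑ α, p.2.1 α • (bas α : Crd m) := by
    ext b
    simp [bas, Finset.sum_apply, Pi.single_apply]
  have hB : (tangentB x p.1).mulVec p.2.1.ofLp = 0 := by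
    have h1 : fderiv ℝ x p.1 p.2.1 = 0 := h0
    rw [hv] at h1
    funext a
    have := congrArg (fun z : Crd n => z a) h1
    simpa [Matrix.mulVec, dotProduct, tangentB, Finset.sum_apply, mul_comm] using this
  apply hp
  have : p.2.1.ofLp = 0 := by
    rw [← Matrix.one_mulVec p.2.1.ofLp, ← h.cotangent_tangent, ← Matrix.mulVec_mulVec, hB,
      Matrix.mulVec_zero]
  ext b
  exact congrFun this b

end Osc2

end

theorem theorem5p2 {m n : ℕ} (hm : 1 < m) (hmn : m < n)
    {M' M : Type*} [TopologicalSpace M'] [ChartedSpace (Crd m) M'] [IsManifold (𝓡 m) ∞ M']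
    [TopologicalSpace M] [ChartedSpace (Crd n) M] [IsManifold (𝓡 n) ∞ M]
    (F : TangentBundle (𝓡 n) M → ℝ) (hF : IsFinsler F)
    (f : M' → M) (hf : IsSmoothImmersion (m := m) (n := n) f)
    (φ : OpenPartialHomeomorph M' (Crd m)) (hφ : φ ∈ IsManifold.maximalAtlas (𝓡 m) ∞ M')
    (ψ : OpenPartialHomeomorph M (Crd n)) (hψ : ψ ∈ IsManifold.maximalAtlas (𝓡 n) ∞ M)
    (Ω : Set (Osc m)) (hΩ : IsOpen Ω) (hΩs : Ω ⊆ slitDomain f φ ψ)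
    (R : MovingFrame m n)
    (hR : ∀ p ∈ Ω, R.IsAdapted (chartFinsler F ψ) (chartMap f φ ψ) p)
    (N : NonlinearConnection m)
    (hN : N = inducedNonlinear (chartFinsler F ψ) (chartMap f φ ψ) R)
    (Γ : NLinear m)
    (hΓ : Γ = inducedTangent (chartFinsler F ψ) (chartMap f φ ψ) R) :
    ∀ p ∈ Ω, ∀ (i : Fin 3) (j : Fin 2) (α β γ : Fin m),
      (covTensor N Γ i 0 (deflection N Γ j i 0) α β γ p
          - covTensor N Γ i 0 (deflection N Γ j i 0) α γ β p
        = ∑ δ, liouville N j δ p * curvR N Γ i δ α β γ p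
          - ∑ δ, deflection N Γ j i 0 α δ p * torsT N Γ i δ β γ p
          - ∑ δ, deflection N Γ j i 1 α δ p * torsR N 0 1 δ β γ p
          - ∑ δ, deflection N Γ j i 2 α δ p * torsR N 0 2 δ β γ p) ∧
      (covTensor N Γ i 1 (deflection N Γ j i 0) α β γ p
          - covTensor N Γ i 0 (deflection N Γ j i 1) α γ β p
        = ∑ δ, liouville N j δ p * curvP N Γ 1 i δ α β γ p
          - ∑ δ, deflection N Γ j i 0 α δ p * Γ i 1 δ β γ p
          - ∑ δ, deflection N Γ j i 1 α δ p * torsPdiag N Γ 1 i δ β γ p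
          - ∑ δ, deflection N Γ j i 2 α δ p * torsPmixed N 1 2 δ β γ p) ∧
      (covTensor N Γ i 2 (deflection N Γ j i 0) α β γ p
          - covTensor N Γ i 0 (deflection N Γ j i 2) α γ β p
        = ∑ δ, liouville N j δ p * curvP N Γ 2 i δ α β γ p
          - ∑ δ, deflection N Γ j i 0 α δ p * Γ i 2 δ β γ p
          - ∑ δ, deflection N Γ j i 1 α δ p * torsPmixed N 2 1 δ β γ p
          - ∑ δ, deflection N Γ j i 2 α δ p * torsPdiag N Γ 2 i δ β γ p) ∧
      (covTensor N Γ i 2 (deflection N Γ j i 1) α β γ p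
          - covTensor N Γ i 1 (deflection N Γ j i 2) α γ β p
        = ∑ δ, liouville N j δ p * curvQ N Γ i δ α β γ p
          - ∑ δ, deflection N Γ j i 1 α δ p * Γ i 2 δ β γ p
          - ∑ δ, deflection N Γ j i 2 α δ p * torsQ N Γ i δ β γ p) ∧
      (∀ l : Fin 3, l = 1 ∨ l = 2 →
        covTensor N Γ i l (deflection N Γ j i l) α β γ p
            - covTensor N Γ i l (deflection N Γ j i l) α γ β p
          = ∑ δ, liouville N j δ p * curvS N Γ l i δ α β γ p
            - ∑ δ, deflection N Γ j i l α δ p * torsS N Γ l i δ β γ p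
            - ∑ δ, deflection N Γ j i 2 α δ p * torsR N l 2 δ β γ p) ∧
      torsR N 2 2 α β γ p = 0 := by
  subst hN hΓ
  intro p hp i j α β γ
  set x := chartMap f φ ψ
  have hT := isOpen_chartMap_domain (φ := φ) (ψ := ψ) hf.1.continuous
  have hxs := contDiffOn_chartMap hf.1 hφ hψ
  have hΩT : Ω ⊆ {p | p.1 ∈ {u | u ∈ φ.target ∧ f (φ.symm u) ∈ ψ.source}} :=
    fun q hq => ⟨(hΩs hq).1, (hΩs hq).2.1⟩
  have hU : IsOpen {q : Osc n | (q.1, q.2.1) ∈ {q : Crd n × Crd n | q.1 ∈ ψ.target ∧ q.2 ≠ 0}} :=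
    (isOpen_slit ψ).preimage (by fun_prop)
  have hg := contDiffOn_fundTensor (isOpen_slit ψ) (contDiffOn_chartFinsler hF hψ)
  have hosc := (contDiffOn_oscMap hT hxs).mono hΩT
  have hmaps : Set.MapsTo (oscMap x) Ω
      {q : Osc n | (q.1, q.2.1) ∈ {q : Crd n × Crd n | q.1 ∈ ψ.target ∧ q.2 ≠ 0}} :=
    fun q hq => ⟨ψ.map_source (hΩs hq).2.1, oscMap_velocity_ne_zero (hR q hq) (hΩs hq).2.2⟩
  have hB := fun a α => (contDiffOn_tangentB hT hxs a α).comp contDiffOn_fst hΩT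
  have hB2 := fun a α β => (contDiffOn_secondB hT hxs a α β).comp contDiffOn_fst hΩT
  have hpos := fun (q : Osc n)
    (hq : (q.1, q.2.1) ∈ {q : Crd n × Crd n | q.1 ∈ ψ.target ∧ q.2 ≠ 0}) =>
      fundTensor_chartFinsler_pos hF hψ hq.1 hq.2
  have hNs := smoothOn_inducedNonlinear hΩ hU hosc hmaps hB hg hpos hR
  exact ricci_identities hΩ hNs
    (contDiffOn_inducedTangent hΩ hU hosc hmaps hB hg hpos hR hB2)
    (contDiffOn_liouville hNs j) hp i α β γ
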